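/- Throughout, the model of computation is the (deterministic) word RAM with words of $O(\log n)$ bits. For integers $k>\ell\ge 3$, the $\ell$-uniform $k$-Hyperclique Hypothesis states that for no $\varepsilon>0$ is there an $O(n^{k-\varepsilon})$-time algorithm which, given an $\ell$-uniform hypergraph on $n$ nodes, finds a hyperclique on $k$ nodes (a set of $k$ nodes all of whose $\ell$-element subsets are hyperedges) or reports that there is none. In the $d$-dimensional Maximum Subarray problem one is given an array $A:\{0,\dots,n-1\}^d\to\mathbb{Z}$ and has to return a non-empty contiguous subarray $\prod_{i=1}^d\{a_i,\dots,b_i\}$ with the largest possible sum of entries. Theorem. There is an absolute constant $C$ such that the following holds for every fixed integer $d\ge 3$. If the $3$-uniform $(2d-2)$-Hyperclique Hypothesis holds, then $d$-dimensional Maximum Subarray, restricted to arrays with all entries in $\{-2^{Cd},\dots,2^{Cd}\}$, requires $n^{2d-2-o(1)}$ time, i.e. for no $\varepsilon>0$ can it be solved in $O(n^{2d-2-\varepsilon})$ time. -/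

import Mathlib

/-! ### The word RAM

A machine with words of `w` bits: registers and a memory of `2 ^ w` cells, all of them holding one
word, the usual arithmetic and bitwise instructions on words (modulo `2 ^ w`), and indirect memory
access. Every instruction, and every evaluation of a branching or loop condition, takes one unit
of time. Programs are finite, do not depend on the input, and mention finitely many registers.
Control flow is given by branching and loops. -/

namespace WordRAM

/-- The binary word operations. Words are read as unsigned numbers modulo `2 ^ w`;
`eq` and `lt` return the word `1` or `0`. -/
inductive BinOp
  | add | sub | mul | div | mod | and | or | xor | shl | shr | eq | lt

/-- The result of a binary operation on `w`-bit words. -/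
def BinOp.eval {w : ℕ} : BinOp → BitVec w → BitVec w → BitVec w
  | .add, x, y => x + y
  | .sub, x, y => x - y
  | .mul, x, y => x * y
  | .div, x, y => x / y
  | .mod, x, y => x % y
  | .and, x, y => x &&& y
  | .or, x, y => x ||| y
  | .xor, x, y => x ^^^ y
  | .shl, x, y => x <<< y
  | .shr, x, y => x >>> y
  | .eq, x, y => if x = y then BitVec.ofNat w 1 else BitVec.ofNat w 0
  | .lt, x, y => if x.toNat < y.toNat then BitVec.ofNat w 1 else BitVec.ofNat w 0

/-- Unit-time instructions; registers are numbered by natural numbers. -/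
inductive Instr
  /-- put the constant `c` (modulo `2 ^ w`) into register `r` -/
  | const (r c : ℕ)
  /-- put the result of the operation on registers `s` and `t` into register `r` -/
  | op (o : BinOp) (r s t : ℕ)
  /-- put the content of the memory cell whose address is in register `s` into register `r` -/
  | load (r s : ℕ)
  /-- put the content of register `s` into the memory cell whose address is in register `r` -/
  | store (r s : ℕ)

/-- Programs. -/
inductive Prog
  | instr (i : Instr)
  | seq (p q : Prog)
  /-- if register `r` is non-zero then `p` else `q` -/
  | ite (r : ℕ) (p q : Prog)
  /-- while register `r` is non-zero do `p` -/
  | loop (r : ℕ) (p : Prog)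

/-- A state of the machine with `w`-bit words. -/
@[ext]
structure State (w : ℕ) where
  reg : ℕ → BitVec w
  mem : BitVec w → BitVec w

/-- The effect of an instruction. -/
def Instr.eval {w : ℕ} : Instr → State w → State w
  | .const r c, σ => { σ with reg := Function.update σ.reg r (BitVec.ofNat w c) }
  | .op o r s t, σ => { σ with reg := Function.update σ.reg r (o.eval (σ.reg s) (σ.reg t)) }
  | .load r s, σ => { σ with reg := Function.update σ.reg r (σ.mem (σ.reg s)) }
  | .store r s, σ => { σ with mem := Function.update σ.mem (σ.reg r) (σ.reg s) }

/-- `Exec p σ t τ`: started in the state `σ`, the program `p` halts after exactly `t` units of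
time in the state `τ`. -/
inductive Exec {w : ℕ} : Prog → State w → ℕ → State w → Prop
  | instr (i : Instr) (σ : State w) : Exec (.instr i) σ 1 (i.eval σ)
  | seq {p q : Prog} {σ τ υ : State w} {t u : ℕ} :
      Exec p σ t τ → Exec q τ u υ → Exec (.seq p q) σ (t + u) υ
  | ite_true {r : ℕ} {p q : Prog} {σ τ : State w} {t : ℕ} :
      σ.reg r ≠ 0 → Exec p σ t τ → Exec (.ite r p q) σ (t + 1) τ
  | ite_false {r : ℕ} {p q : Prog} {σ τ : State w} {t : ℕ} :
      σ.reg r = 0 → Exec q σ t τ → Exec (.ite r p q) σ (t + 1) τ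
  | loop_done {r : ℕ} {p : Prog} {σ : State w} :
      σ.reg r = 0 → Exec (.loop r p) σ 1 σ
  | loop_step {r : ℕ} {p : Prog} {σ τ υ : State w} {t u : ℕ} :
      σ.reg r ≠ 0 → Exec p σ t τ → Exec (.loop r p) τ u υ → Exec (.loop r p) σ (t + u + 1) υ

/-- The initial state: the input occupies the memory cells `0, 1, 2, …`, one integer per word in
two's complement; the other cells and all registers are zero. -/
def initial (w : ℕ) (input : List ℤ) : State w where
  reg := fun _ => 0
  mem := fun a => BitVec.ofInt w (input.getD a.toNat 0)

/-- The input fits into the memory of the machine: there are enough cells, and every integer has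
a two's complement representation in `w` bits. -/
def Fits (w : ℕ) (input : List ℤ) : Prop :=
  input.length ≤ 2 ^ w ∧ ∀ z ∈ input, -(2 ^ w : ℤ) ≤ 2 * z ∧ 2 * z < (2 ^ w : ℤ)

/-- The output: the memory contents `0, 1, 2, …`, read as unsigned numbers. -/
def State.output {w : ℕ} (σ : State w) (i : ℕ) : ℕ := (σ.mem (BitVec.ofNat w i)).toNat

/-- A computational problem: instances with a size parameter `n`, the list of integers by which an
instance is given to the machine, and the predicate telling which outputs are correct. -/
structure Problem where
  Inst : ℕ → Type
  input : {n : ℕ} → Inst n → List ℤ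
  Correct : {n : ℕ} → Inst n → (ℕ → ℕ) → Prop

/-- In the word RAM with words of `O(log n)` bits, the problem is solved in time `O(f n)` by some
program: there are a program `p`, a word length `a * ⌊log₂ n⌋ + b` and a constant `K` such that on
all instances of size `n ≥ 1` the program halts with a correct output in time at most `K * f n`. -/
def Problem.SolvableInTime (Q : Problem) (f : ℕ → ℝ) : Prop :=
  ∃ (p : Prog) (a b : ℕ) (K : ℝ), ∀ n : ℕ, 1 ≤ n → ∀ x : Q.Inst n,
    Fits (a * Nat.log 2 n + b) (Q.input x) ∧
    ∃ (t : ℕ) (τ : State (a * Nat.log 2 n + b)),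
      Exec p (initial (a * Nat.log 2 n + b) (Q.input x)) t τ ∧
      (t : ℝ) ≤ K * f n ∧ Q.Correct x τ.output

/-- The problem requires time `n ^ (e - o(1))`: for no `ε > 0` is there an algorithm running in
time `O(n ^ (e - ε))`. -/
def Problem.RequiresExponent (Q : Problem) (e : ℝ) : Prop :=
  ∀ ε : ℝ, 0 < ε → ¬ Q.SolvableInTime (fun n => (n : ℝ) ^ (e - ε))

end WordRAM

/-! ### Hypercliques -/

/-- An `ℓ`-uniform hypergraph on the vertex set `{0, …, n - 1}`. -/
structure UniformHypergraph (ℓ n : ℕ) where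
  edges : Finset (Finset (Fin n))
  uniform : ∀ e ∈ edges, e.card = ℓ

/-- `S` is a hyperclique: all `ℓ`-element subsets of `S` are hyperedges. -/
def UniformHypergraph.IsHyperclique {ℓ n : ℕ} (G : UniformHypergraph ℓ n)
    (S : Finset (Fin n)) : Prop :=
  ∀ e : Finset (Fin n), e ⊆ S → e.card = ℓ → e ∈ G.edges

/-- The entry of the adjacency tensor at `(v 0, …, v (ℓ - 1))`: `1` if these vertices form a
hyperedge (in particular they are then distinct), and `0` otherwise. -/
def UniformHypergraph.adj {ℓ n : ℕ} (G : UniformHypergraph ℓ n) (v : Fin ℓ → Fin n) : ℤ :=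
  if Finset.univ.image v ∈ G.edges then 1 else 0

/-- Find a hyperclique on `k` nodes in a given `n`-node `ℓ`-uniform hypergraph. The input consists
of `n` followed by the adjacency tensor, whose entry at `v` has position `1 + ∑ i, v i * n ^ i`. The
output is `1` followed by the `k` vertices of a hyperclique, or `0` if there is none. -/
def hypercliqueProblem (ℓ k : ℕ) : WordRAM.Problem where
  Inst := UniformHypergraph ℓ
  input := fun {n} G =>
    (n : ℤ) :: List.ofFn (fun i : Fin (n ^ ℓ) => G.adj (finFunctionFinEquiv.symm i))
  Correct := fun {n} G out =>
    (out 0 = 1 ∧ ∃ v : Fin k → Fin n, Function.Injective v ∧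
      G.IsHyperclique (Finset.univ.image v) ∧ ∀ i : Fin k, out (1 + i) = v i) ∨
    (out 0 = 0 ∧ ¬ ∃ S : Finset (Fin n), S.card = k ∧ G.IsHyperclique S)

/-- The `ℓ`-uniform `k`-hyperclique hypothesis: in the word RAM with words of `O(log n)` bits, no
algorithm finds a hyperclique on `k` nodes in time `O(n ^ (k - ε))` for some `ε > 0`. -/
def HypercliqueHypothesis (ℓ k : ℕ) : Prop :=
  (hypercliqueProblem ℓ k).RequiresExponent k

/-! ### Maximum Subarray -/

/-- Given a `d`-dimensional array of side length `n` with integer entries in `{-M, …, M}`, find a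
(non-empty) contiguous subarray with maximum entry sum. The input consists of `n` followed by the
entries, the one at `x` having position `1 + ∑ i, x i * n ^ i`. The output consists of the least
index vector `lo` and the greatest index vector `hi` of the subarray. -/
def maxSubarrayProblem (d M : ℕ) : WordRAM.Problem where
  Inst := fun n => {A : (Fin d → Fin n) → ℤ // ∀ x, |A x| ≤ (M : ℤ)}
  input := fun {n} A =>
    (n : ℤ) :: List.ofFn (fun i : Fin (n ^ d) => A.1 (finFunctionFinEquiv.symm i))
  Correct := fun {n} A out =>
    ∃ lo hi : Fin d → Fin n, lo ≤ hi ∧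
      (∀ lo' hi' : Fin d → Fin n, lo' ≤ hi' →
        ∑ x ∈ Finset.Icc lo' hi', A.1 x ≤ ∑ x ∈ Finset.Icc lo hi, A.1 x) ∧
      ∀ i : Fin d, out i = lo i ∧ out (d + i) = hi i

/-! Write d = D + 1. A hypergraph on N vertices becomes an array of side 8N that is the mixed
difference of a function F (`gridValue`), so a box sum is the alternating sum of F over the 2^d
corners of the box (`sum_mixedDiff`). Coordinates up to N are reserved for lower ends and the next N
+ 1 for upper ends. A sign built into F cancels the alternating sign, so such boxes have as sum a
total of weights in {0, 1, 2}. The two ends in each of the first D directions name 2D vertices, and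
weight 2 at every corner is to certify that these form a hyperclique.

A corner sees only one of the two ends in each direction, so a triple containing both ends of
direction i is never directly visible. The last direction repairs this: its ends are checksums
making the lower values, and likewise the upper values, sum to 0 modulo N. At a corner with one kind
of end in direction i and the other kind everywhere else, the unseen end of direction i is recovered
from the other coordinates. Hence all triples are tested (`forall_consistent_iff`).

The dummy value N covers the absence of a hyperclique. The box with only dummy ends has sum 2^(D+2)
- 1 (`boxSum_dummy`), one less than the upper bound, which a hyperclique attains. A maximum box
therefore earns at least 1 at every corner, which forces its ends into the reserved ranges.
Comparing its first lower end with N then tells whether there is no hyperclique or one can be read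
off the ends (`of_le_boxSum`, `correct_instanceOf`).

For fixed D every entry is a straight-line expression, so the reduction costs O(N^(D+1)), at most
order N^(2D-ε) when ε ≤ 1 and D ≥ 2. Memory is only known to hold the array itself, so the array is
built in place, with its identically zero upper half as scratch space (`exec_prepare`). -/

namespace WordRAM

/-! ### Expressions and their compilation -/

/-- Straight-line expressions over registers and memory. -/
inductive Expr
  | reg (r : ℕ)
  | const (c : ℕ)
  | op (o : BinOp) (e f : Expr)
  | load (e : Expr)

namespace Expr

/-- The value of an expression in a state. -/
def eval {w : ℕ} (σ : State w) : Expr → BitVec w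
  | reg r => σ.reg r
  | const c => BitVec.ofNat w c
  | op o e f => o.eval (e.eval σ) (f.eval σ)
  | load e => σ.mem (e.eval σ)

/-- All registers of the expression are less than its bound. -/
def bound : Expr → ℕ
  | reg r => r + 1
  | const _ => 0
  | op _ e f => max e.bound f.bound
  | load e => e.bound

/-- The number of instructions of the compiled expression. -/
def cost : Expr → ℕ
  | reg _ => 1
  | const _ => 1
  | op _ e f => e.cost + (f.cost + 1)
  | load e => e.cost + 1

/-- The program that puts the value of the expression into register `t`, using only registers
from `t` on. -/
def compile : Expr → ℕ → Prog
  | reg r, t => .instr (.op .or t r r)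
  | const c, t => .instr (.const t c)
  | op o e f, t =>
      .seq (e.compile t) (.seq (f.compile (t + 1)) (.instr (.op o t t (t + 1))))
  | load e, t => .seq (e.compile t) (.instr (.load t t))

theorem eval_congr {w : ℕ} {σ τ : State w} (hm : τ.mem = σ.mem) (e : Expr)
    (hr : ∀ s < e.bound, τ.reg s = σ.reg s) : e.eval τ = e.eval σ := by
  induction e with
  | reg r => exact hr r (Nat.lt_succ_self r)
  | const c => rfl
  | op o e f he hf =>
    simp only [eval]
    rw [he fun s hs => hr s (lt_max_of_lt_left hs), hf fun s hs => hr s (lt_max_of_lt_right hs)]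
  | load e he => simp only [eval]; rw [he hr, hm]

/-- Registers from `t` on serve as a stack: the left operand waits in `t` while the right one is
evaluated from `t + 1` on. The bound keeps the registers that `e` reads below the stack. -/
theorem exec_compile {w : ℕ} (e : Expr) (t : ℕ) (ht : e.bound ≤ t) (σ : State w) :
    ∃ τ : State w, Exec (e.compile t) σ e.cost τ ∧ τ.mem = σ.mem ∧ τ.reg t = e.eval σ ∧
      ∀ s < t, τ.reg s = σ.reg s := by
  induction e generalizing t σ with
  | reg r =>
    refine ⟨_, Exec.instr _ _, rfl, ?_, fun s hs => ?_⟩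
    · simp [Instr.eval, BinOp.eval, eval]
    · simp [Instr.eval, hs.ne]
  | const c =>
    refine ⟨_, Exec.instr _ _, rfl, ?_, fun s hs => ?_⟩
    · simp [Instr.eval, eval]
    · simp [Instr.eval, hs.ne]
  | op o e f he hf =>
    obtain ⟨τ₁, h₁, m₁, v₁, r₁⟩ := he t ((le_max_left _ _).trans ht) σ
    have hft : f.bound ≤ t := (le_max_right _ _).trans ht
    obtain ⟨τ₂, h₂, m₂, v₂, r₂⟩ := hf (t + 1) (hft.trans (Nat.le_succ t)) τ₁
    refine ⟨_, Exec.seq h₁ (Exec.seq h₂ (Exec.instr _ _)), ?_, ?_, fun s hs => ?_⟩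
    · simp [Instr.eval, m₁, m₂]
    · have : f.eval τ₁ = f.eval σ := eval_congr m₁ f fun s hs => r₁ s (hs.trans_le hft)
      simp [Instr.eval, eval, v₂, r₂ t (Nat.lt_succ_self t), v₁, this]
    · simp [Instr.eval, hs.ne, r₂ s (hs.trans (Nat.lt_succ_self t)), r₁ s hs]
  | load e he =>
    obtain ⟨τ₁, h₁, m₁, v₁, r₁⟩ := he t ht σ
    refine ⟨_, Exec.seq h₁ (Exec.instr _ _), ?_, ?_, fun s hs => ?_⟩
    · simp [Instr.eval, m₁]
    · simp [Instr.eval, eval, v₁, m₁]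
    · simp [Instr.eval, hs.ne, r₁ s hs]

end Expr

/-- Put the value of `e` into register `r`, changing no other register below `P`. -/
def assign (P r : ℕ) (e : Expr) : Prog :=
  .seq (e.compile (max e.bound P)) (.instr (.op .or r (max e.bound P) (max e.bound P)))

theorem exec_assign {w : ℕ} (P r : ℕ) (e : Expr) (σ : State w) :
    ∃ τ : State w, Exec (assign P r e) σ (e.cost + 1) τ ∧ τ.mem = σ.mem ∧
      τ.reg r = e.eval σ ∧ ∀ s < P, s ≠ r → τ.reg s = σ.reg s := by
  obtain ⟨τ, h, m, v, hr⟩ := e.exec_compile (max e.bound P) (le_max_left _ _) σ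
  refine ⟨_, Exec.seq h (Exec.instr _ _), ?_, ?_, fun s hs hsr => ?_⟩
  · simp [Instr.eval, m]
  · simp [Instr.eval, BinOp.eval, v]
  · simp [Instr.eval, hsr, hr s (lt_max_of_lt_right hs)]

/-- Put the value of `f` into the memory cell whose address is the value of `e`, changing no
register below `P`. -/
def assignMem (P : ℕ) (e f : Expr) : Prog :=
  .seq (e.compile (max (max e.bound f.bound) P))
    (.seq (f.compile (max (max e.bound f.bound) P + 1))
      (.instr (.store (max (max e.bound f.bound) P) (max (max e.bound f.bound) P + 1))))

theorem exec_assignMem {w : ℕ} (P : ℕ) (e f : Expr) (σ : State w) :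
    ∃ τ : State w, Exec (assignMem P e f) σ (e.cost + (f.cost + 1)) τ ∧
      τ.mem = Function.update σ.mem (e.eval σ) (f.eval σ) ∧ ∀ s < P, τ.reg s = σ.reg s := by
  set t := max (max e.bound f.bound) P with ht
  have het : e.bound ≤ t := (le_max_left _ _).trans (le_max_left _ _)
  have hft : f.bound ≤ t := (le_max_right _ _).trans (le_max_left _ _)
  obtain ⟨τ₁, h₁, m₁, v₁, r₁⟩ := e.exec_compile t het σ
  obtain ⟨τ₂, h₂, m₂, v₂, r₂⟩ := f.exec_compile (t + 1) (hft.trans (Nat.le_succ t)) τ₁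
  have hf : f.eval τ₁ = f.eval σ := Expr.eval_congr m₁ f fun s hs => r₁ s (hs.trans_le hft)
  refine ⟨_, Exec.seq h₁ (Exec.seq h₂ (Exec.instr _ _)), ?_, fun s hs => ?_⟩
  · simp [Instr.eval, ← ht, m₁, m₂, v₂, r₂ t (Nat.lt_succ_self t), v₁, hf]
  · have hst : s < t := lt_max_of_lt_right hs
    simp [Instr.eval, r₂ s (hst.trans (Nat.lt_succ_self t)), r₁ s hst]

/-! ### Loops filling a range of cells -/

/-- The memory contents `G`, with the cells `A + lo, …, A + M - 1` holding `g lo, …, g (M - 1)`. -/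
def filled {α : Type*} (G : ℕ → α) (A : ℕ) (g : ℕ → α) (lo M : ℕ) (b : ℕ) : α :=
  if A + lo ≤ b ∧ b < A + M then g (b - A) else G b

/-- Count register `r` down to zero; after each decrement perform one memory assignment. -/
def countdown (P r : ℕ) (e f : Expr) : Prog :=
  .loop r (.seq (assign P r (.op .sub (.reg r) (.const 1))) (assignMem P e f))

/-- The time of one iteration of `countdown`. -/
def countdownCost (e f : Expr) : ℕ := e.cost + f.cost + 6

/-- When index `i` is treated, only the cells above `A + i` in the range are new. So `body` may
still read old contents from `A + i` downwards, which permits overlapping shifts in place. -/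
theorem exec_countdown {w : ℕ} (P r : ℕ) (hr : r < P) (e f : Expr) (A M : ℕ)
    (G g : ℕ → BitVec w) (σ : State w)
    (hσ : σ.mem = fun a => G a.toNat) (hM : (σ.reg r).toNat = M)
    (body : ∀ i < M, ∀ τ : State w, (∀ s < P, s ≠ r → τ.reg s = σ.reg s) →
      (τ.reg r).toNat = i → (τ.mem = fun a => filled G A g (i + 1) M a.toNat) →
      (e.eval τ).toNat = A + i ∧ f.eval τ = g i) :
    ∃ τ : State w, Exec (countdown P r e f) σ (M * countdownCost e f + 1) τ ∧
      (∀ s < P, s ≠ r → τ.reg s = σ.reg s) ∧ τ.mem = fun a => filled G A g 0 M a.toNat := by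
  suffices H : ∀ k ≤ M, ∀ ρ : State w, (∀ s < P, s ≠ r → ρ.reg s = σ.reg s) →
      (ρ.reg r).toNat = k → (ρ.mem = fun a => filled G A g k M a.toNat) →
      ∃ τ : State w, Exec (countdown P r e f) ρ (k * countdownCost e f + 1) τ ∧
      (∀ s < P, s ≠ r → τ.reg s = σ.reg s) ∧ τ.mem = fun a => filled G A g 0 M a.toNat by
    refine H M le_rfl σ (fun _ _ _ => rfl) hM ?_
    rw [hσ]
    funext a
    rw [filled, if_neg (by omega)]
  intro k
  induction k with
  | zero =>
    intro _ ρ h₁ h₂ h₃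
    refine ⟨ρ, ?_, h₁, h₃⟩
    rw [zero_mul]
    exact Exec.loop_done (BitVec.eq_of_toNat_eq (by simpa using h₂))
  | succ k ih =>
    intro hk ρ h₁ h₂ h₃
    have hk2 : k + 1 < 2 ^ w := h₂ ▸ (ρ.reg r).isLt
    have h1w : 1 < 2 ^ w := by omega
    obtain ⟨ρ₁, x₁, m₁, v₁, r₁⟩ := exec_assign P r (.op .sub (.reg r) (.const 1)) ρ
    have hv : (ρ₁.reg r).toNat = k := by
      rw [v₁]
      have hone : (BitVec.ofNat w 1).toNat = 1 := by
        rw [BitVec.toNat_ofNat, Nat.mod_eq_of_lt h1w]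
      simp only [Expr.eval, BinOp.eval]
      rw [BitVec.toNat_sub_of_le (by rw [BitVec.le_def, hone]; omega), hone]
      omega
    have hkeep : ∀ s < P, s ≠ r → ρ₁.reg s = σ.reg s := fun s hs hsr =>
      (r₁ s hs hsr).trans (h₁ s hs hsr)
    obtain ⟨ea, ev⟩ := body k hk ρ₁ hkeep hv (m₁.trans h₃)
    obtain ⟨ρ₂, x₂, m₂, r₂⟩ := exec_assignMem P e f ρ₁
    obtain ⟨τ, x₃, h⟩ := ih (by omega) ρ₂
      (fun s hs hsr => (r₂ s hs).trans (hkeep s hs hsr)) (by rw [r₂ r hr, hv]) (by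
        rw [m₂, m₁, h₃]
        funext a
        by_cases ha : a = e.eval ρ₁
        · rw [ha, Function.update_self, ev, filled, ea, if_pos (by omega), Nat.add_sub_cancel_left]
        · rw [Function.update_of_ne ha]
          have : a.toNat ≠ A + k := fun h => ha (BitVec.eq_of_toNat_eq (h.trans ea.symm))
          unfold filled
          congr 1
          apply propext
          omega)
    refine ⟨τ, ?_, h⟩
    have hne : ρ.reg r ≠ 0 := by
      intro h0
      rw [h0] at h₂
      simp at h₂
    have ht : (k + 1) * countdownCost e f + 1 = (Expr.op .sub (.reg r) (.const 1)).cost + 1 +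
        (e.cost + (f.cost + 1)) + (k * countdownCost e f + 1) + 1 := by
      simp only [countdownCost, Expr.cost]
      ring
    rw [ht]
    exact Exec.loop_step hne (Exec.seq x₁ x₂) x₃

/-! ### Independence of registers that are not mentioned -/

/-- A number above all registers of the instruction. -/
def Instr.bound : Instr → ℕ
  | .const r _ => r + 1
  | .op _ r s t => max r (max s t) + 1
  | .load r s => max r s + 1
  | .store r s => max r s + 1

/-- A number above all registers of the program. -/
def Prog.bound : Prog → ℕ
  | .instr i => i.bound
  | .seq p q => max p.bound q.bound
  | .ite r p q => max (r + 1) (max p.bound q.bound)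
  | .loop r p => max (r + 1) p.bound

/-- A program neither reads nor writes registers from its bound on. This lets the number of vertices
survive a run of the subarray solver, which expects its own registers to be zero. -/
theorem Exec.frame {w : ℕ} (R : ℕ) {p : Prog} {σ τ : State w} {t : ℕ} (h : Exec p σ t τ) :
    p.bound ≤ R → ∀ σ' : State w, σ'.mem = σ.mem → (∀ s < R, σ'.reg s = σ.reg s) →
      ∃ τ' : State w, Exec p σ' t τ' ∧ τ'.mem = τ.mem ∧ (∀ s < R, τ'.reg s = τ.reg s) ∧
        ∀ s, R ≤ s → τ'.reg s = σ'.reg s := by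
  induction h with
  | instr i σ =>
    intro hb σ' hm hr
    refine ⟨_, Exec.instr i σ', ?_⟩
    cases i with
    | const r c =>
      simp only [Prog.bound, Instr.bound] at hb
      refine ⟨hm, fun s hs => ?_, fun s hs => ?_⟩
      · simp only [Instr.eval, Function.update_apply, hr s hs]
      · simp only [Instr.eval, Function.update_apply]
        rw [if_neg (by omega)]
    | op o r x y =>
      simp only [Prog.bound, Instr.bound] at hb
      refine ⟨hm, fun s hs => ?_, fun s hs => ?_⟩
      · simp only [Instr.eval, Function.update_apply, hr s hs, hr x (by omega), hr y (by omega)]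
      · simp only [Instr.eval, Function.update_apply]
        rw [if_neg (by omega)]
    | load r x =>
      simp only [Prog.bound, Instr.bound] at hb
      refine ⟨hm, fun s hs => ?_, fun s hs => ?_⟩
      · simp only [Instr.eval, Function.update_apply, hr s hs, hr x (by omega), hm]
      · simp only [Instr.eval, Function.update_apply]
        rw [if_neg (by omega)]
    | store x y =>
      simp only [Prog.bound, Instr.bound] at hb
      refine ⟨?_, fun s hs => hr s hs, fun s _ => rfl⟩
      simp only [Instr.eval, hm, hr x (by omega), hr y (by omega)]
  | seq _ _ ih₁ ih₂ =>
    intro hb σ' hm hr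
    simp only [Prog.bound] at hb
    obtain ⟨τ₁, x₁, m₁, r₁, s₁⟩ := ih₁ (by omega) σ' hm hr
    obtain ⟨τ₂, x₂, m₂, r₂, s₂⟩ := ih₂ (by omega) τ₁ m₁ r₁
    exact ⟨τ₂, Exec.seq x₁ x₂, m₂, r₂, fun s hs => (s₂ s hs).trans (s₁ s hs)⟩
  | @ite_true r _ _ _ _ _ h0 _ ih =>
    intro hb σ' hm hr
    simp only [Prog.bound] at hb
    obtain ⟨τ₁, x₁, h⟩ := ih (by omega) σ' hm hr
    exact ⟨τ₁, Exec.ite_true (by rwa [hr r (by omega)]) x₁, h⟩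
  | @ite_false r _ _ _ _ _ h0 _ ih =>
    intro hb σ' hm hr
    simp only [Prog.bound] at hb
    obtain ⟨τ₁, x₁, h⟩ := ih (by omega) σ' hm hr
    exact ⟨τ₁, Exec.ite_false (by rwa [hr r (by omega)]) x₁, h⟩
  | @loop_done r p σ h0 =>
    intro hb σ' hm hr
    simp only [Prog.bound] at hb
    exact ⟨σ', Exec.loop_done (by rwa [hr r (by omega)]), hm, hr, fun _ _ => rfl⟩
  | @loop_step r p _ _ _ _ _ h0 _ _ ih₁ ih₂ =>
    intro hb σ' hm hr
    have hb' := hb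
    simp only [Prog.bound] at hb'
    obtain ⟨τ₁, x₁, m₁, r₁, s₁⟩ := ih₁ (by omega) σ' hm hr
    obtain ⟨τ₂, x₂, m₂, r₂, s₂⟩ := ih₂ hb τ₁ m₁ r₁
    exact ⟨τ₂, Exec.loop_step (by rwa [hr r (by omega)]) x₁ x₂, m₂, r₂,
      fun s hs => (s₂ s hs).trans (s₁ s hs)⟩

end WordRAM

/-! ### The array of a hypergraph

A grid coordinate `c` stands for a lower end with value `c` if `c ≤ N`, and for an upper end with
value `c - (N + 1)` if `N < c ≤ 2 * N + 1`; the value `N` is a dummy. -/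

namespace CliqueArray

/-- The product of the signs of the corners of a box given by `δ`. -/
def cornerSign {d : ℕ} (δ : Fin d → Bool) : ℤ := ∏ i, if δ i then 1 else -1

/-- The mixed difference of `F` at `x`. -/
def mixedDiff {d : ℕ} (F : (Fin d → ℕ) → ℤ) (x : Fin d → ℕ) : ℤ :=
  ∑ δ : Fin d → Bool, cornerSign δ * F fun i => x i + (δ i).toNat

/-- The corner given by `δ` of the box between `L` and `R`. -/
def corner {d : ℕ} (L R : Fin d → ℕ) (δ : Fin d → Bool) : Fin d → ℕ :=
  fun i => if δ i then R i else L i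

/-- For a product of one-variable functions both sides factor, and each factor telescopes. The
general case follows by linearity, since point indicators on a finite grid are such products. -/
theorem sum_mixedDiff {d n : ℕ} (F : (Fin d → ℕ) → ℤ) (lo hi : Fin d → Fin n) (h : lo ≤ hi) :
    ∑ x ∈ Finset.Icc lo hi, mixedDiff F (fun i => x i) =
      ∑ δ : Fin d → Bool, cornerSign δ * F (corner (fun i => lo i) (fun i => hi i + 1) δ) := by
  classical
  have key : ∀ f : Fin d → ℕ → ℤ,
      ∑ x ∈ Finset.Icc lo hi, ∑ δ : Fin d → Bool,
        ∏ i, ((if δ i then 1 else -1) * f i (x i + (δ i).toNat)) =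
      ∑ δ : Fin d → Bool, ∏ i, ((if δ i then 1 else -1) *
        f i (corner (fun i => lo i) (fun i => hi i + 1) δ i)) := by
    intro f
    have e : ∀ g : Fin d → Bool → ℤ, ∑ δ : Fin d → Bool, ∏ i, g i (δ i) =
        ∏ i, (g i true + g i false) := by
      intro g
      have := Finset.prod_univ_sum (fun _ : Fin d => (Finset.univ : Finset Bool)) g
      rw [Fintype.piFinset_univ] at this
      rw [← this]
      simp
    have e₁ : ∀ x : Fin d → Fin n, ∑ δ : Fin d → Bool,
        ∏ i, ((if δ i then 1 else -1) * f i (x i + (δ i).toNat)) =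
        ∏ i, (f i (x i + 1) - f i (x i)) := by
      intro x
      rw [e fun i b => (if b then 1 else -1) * f i (x i + b.toNat)]
      simp [sub_eq_add_neg]
    simp only [e₁]
    rw [Pi.Icc_eq, ← Finset.prod_univ_sum (fun i => Finset.Icc (lo i) (hi i))
      (fun i (y : Fin n) => f i (y + 1) - f i y)]
    have e₂ : ∀ i, ∑ y ∈ Finset.Icc (lo i) (hi i), (f i ((y : ℕ) + 1) - f i y) =
        f i (hi i + 1) - f i (lo i) := by
      intro i
      have h1 : ∑ y ∈ Finset.Icc (lo i) (hi i), (f i ((y : ℕ) + 1) - f i y) =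
          ∑ y ∈ (Finset.Icc (lo i) (hi i)).map Fin.valEmbedding, (f i (y + 1) - f i y) := by
        rw [Finset.sum_map]
        rfl
      rw [h1, Fin.map_valEmbedding_Icc, ← Finset.Ico_succ_right_eq_Icc]
      exact Finset.sum_Ico_sub (f i) ((Fin.le_iff_val_le_val.1 (h i)).trans (Nat.le_succ _))
    simp only [e₂, corner]
    rw [e fun i b => (if b then 1 else -1) * f i (if b then (hi i : ℕ) + 1 else lo i)]
    simp [sub_eq_add_neg]
  -- The grid includes the coordinate `n`, because upper corners are `hi + 1`.
  set B : Finset (Fin d → ℕ) := Fintype.piFinset fun _ => Finset.range (n + 1) with hB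
  have expand : ∀ c ∈ B, F c = ∑ y ∈ B, F y * ∏ i, if c i = y i then 1 else 0 := by
    intro c hc
    rw [Finset.sum_eq_single c]
    · simp
    · intro y _ hy
      obtain ⟨i, hi⟩ := Function.ne_iff.1 hy
      rw [Finset.prod_eq_zero (Finset.mem_univ i) (if_neg fun h => hi h.symm), mul_zero]
    · exact fun h => (h hc).elim
  have lhs : ∀ x ∈ Finset.Icc lo hi, mixedDiff F (fun i => x i) =
      ∑ y ∈ B, F y * ∑ δ : Fin d → Bool,
        ∏ i, ((if δ i then 1 else -1) * if (x i : ℕ) + (δ i).toNat = y i then 1 else 0) := by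
    intro x _
    simp only [mixedDiff, Finset.mul_sum]
    rw [Finset.sum_comm]
    refine Finset.sum_congr rfl fun δ _ => ?_
    rw [expand _ (by
      rw [hB, Fintype.mem_piFinset]
      intro i
      have := (x i).isLt
      have := Bool.toNat_le (δ i)
      rw [Finset.mem_range]
      omega), Finset.mul_sum]
    refine Finset.sum_congr rfl fun y _ => ?_
    rw [Finset.prod_mul_distrib, cornerSign]
    ring
  rw [Finset.sum_congr rfl lhs, Finset.sum_comm]
  simp only [← Finset.mul_sum]
  have : ∀ y ∈ B, _ := fun y _ => congrArg (F y * ·) (key fun i c => if c = y i then 1 else 0)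
  rw [Finset.sum_congr rfl this]
  simp only [Finset.mul_sum]
  rw [Finset.sum_comm]
  refine Finset.sum_congr rfl fun δ _ => ?_
  rw [expand (corner _ _ δ) (by
    rw [hB, Fintype.mem_piFinset]
    intro i
    have := (lo i).isLt
    have := (hi i).isLt
    rw [Finset.mem_range, corner]
    split_ifs <;> omega), Finset.mul_sum]
  refine Finset.sum_congr rfl fun y _ => ?_
  rw [Finset.prod_mul_distrib, cornerSign]
  ring

end CliqueArray

/-! ### Corner weights and the consistency of a box -/

namespace CliqueArray

/-- The value completing the values `v j` for `j ≠ i` to a sum that is divisible by `N`. -/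
def complement (N : ℕ) {d : ℕ} (v : Fin d → ℕ) (i : Fin d) : ℕ :=
  (∑ j ∈ Finset.univ.erase i, (N - v j)) % N

/-- The conditions on the hypergraph with edge relation `E` that are tested at a grid point. -/
structure Consistent (N : ℕ) {D : ℕ} (E : ℕ → ℕ → ℕ → Prop) (c : Fin (D + 1) → ℕ) : Prop where
  checksum : (∀ i j, c i / (N + 1) = c j / (N + 1)) → (∑ i, c i % (N + 1)) % N = 0
  cross : ∀ i j k : Fin D, i ≠ j → i ≠ k → j ≠ k → E (c i.castSucc % (N + 1) % N)
    (c j.castSucc % (N + 1) % N) (c k.castSucc % (N + 1) % N)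
  outlier : ∀ i j : Fin D, i ≠ j →
    (∀ k, k ≠ i.castSucc → c k / (N + 1) ≠ c i.castSucc / (N + 1)) →
    E (complement N (fun k => c k % (N + 1)) i.castSucc) (c i.castSucc % (N + 1) % N)
      (c j.castSucc % (N + 1) % N)

open scoped Classical in
/-- The absolute value of the prefix sums at a grid point. -/
noncomputable def weight (N : ℕ) {D : ℕ} (E : ℕ → ℕ → ℕ → Prop) (c : Fin (D + 1) → ℕ) : ℕ :=
  (if ∀ i, c i % (N + 1) = N then (if ∀ i, c i / (N + 1) = 0 then 1 else 2) else 0) +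
    (if (∀ i, c i % (N + 1) ≠ N) ∧ Consistent N E c then 2 else 0)

/-- The sign of a grid coordinate. -/
def gridSign (N c : ℕ) : ℤ :=
  (if c / (N + 1) = 1 then 1 else 0) - (if c / (N + 1) = 0 then 1 else 0)

/-- The prefix sums of the array. -/
noncomputable def gridValue (N : ℕ) {D : ℕ} (E : ℕ → ℕ → ℕ → Prop) (c : Fin (D + 1) → ℕ) : ℤ :=
  (∏ i, gridSign N (c i)) * weight N E c

/-- The sum of the array over the box between `L` (inclusive) and `R` (exclusive). -/
noncomputable def boxSum (N : ℕ) {D : ℕ} (E : ℕ → ℕ → ℕ → Prop) (L R : Fin (D + 1) → ℕ) : ℤ :=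
  ∑ δ : Fin (D + 1) → Bool, cornerSign δ * gridValue N E (corner L R δ)

/-- The grid point whose `i`-th coordinate stands for an end of kind `δ i` with value
`u (δ i) i`. -/
def gridPoint (N : ℕ) {d : ℕ} (u : Bool → Fin d → ℕ) (δ : Fin d → Bool) : Fin d → ℕ :=
  fun i => u (δ i) i + (N + 1) * (δ i).toNat

/-- Any three of the points in the family span an edge. -/
def IsCliqueFamily {D : ℕ} (E : ℕ → ℕ → ℕ → Prop) (f : Fin D × Bool → ℕ) : Prop :=
  ∀ p q r, p ≠ q → p ≠ r → q ≠ r → E (f p) (f q) (f r)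

variable {N D : ℕ} {E : ℕ → ℕ → ℕ → Prop}

/-- Adding the total, which vanishes modulo `N`, cancels all terms but `v i`; the bound `v i < N`
turns the congruence into equality. -/
theorem complement_eq {d : ℕ} {v : Fin d → ℕ} (hv : ∀ i, v i < N) (h : (∑ i, v i) % N = 0)
    (i : Fin d) : complement N v i = v i := by
  have h₁ : ∑ j ∈ Finset.univ.erase i, (N - v j) + ∑ j, v j =
      v i + (Finset.univ.erase i).card * N := by
    rw [← Finset.add_sum_erase _ v (Finset.mem_univ i), add_left_comm, ← Finset.sum_add_distrib,
      Finset.sum_congr rfl fun j _ => Nat.sub_add_cancel (hv j).le, Finset.sum_const, smul_eq_mul]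
  have h₂ := congrArg (· % N) h₁
  simp only [Nat.add_mul_mod_self_right] at h₂
  rw [Nat.add_mod, h, add_zero, Nat.mod_mod, Nat.mod_eq_of_lt (hv i)] at h₂
  exact h₂

theorem complement_congr {d : ℕ} {v v' : Fin d → ℕ} {i : Fin d} (h : ∀ j, j ≠ i → v j = v' j) :
    complement N v i = complement N v' i := by
  unfold complement
  rw [Finset.sum_congr rfl fun j hj => by rw [h j (Finset.ne_of_mem_erase hj)]]

theorem gridPoint_div {d : ℕ} {u : Bool → Fin d → ℕ} (hu : ∀ β i, u β i ≤ N) (δ : Fin d → Bool)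
    (i : Fin d) : gridPoint N u δ i / (N + 1) = (δ i).toNat := by
  rw [gridPoint, Nat.add_mul_div_left _ _ N.succ_pos,
    Nat.div_eq_of_lt (Nat.lt_succ_of_le (hu _ _)), zero_add]

theorem gridPoint_mod {d : ℕ} {u : Bool → Fin d → ℕ} (hu : ∀ β i, u β i ≤ N) (δ : Fin d → Bool)
    (i : Fin d) : gridPoint N u δ i % (N + 1) = u (δ i) i := by
  rw [gridPoint, Nat.add_mul_mod_self_left, Nat.mod_eq_of_lt (Nat.lt_succ_of_le (hu _ _))]

theorem gridSign_gridPoint {d : ℕ} {u : Bool → Fin d → ℕ} (hu : ∀ β i, u β i ≤ N)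
    (δ : Fin d → Bool) (i : Fin d) :
    gridSign N (gridPoint N u δ i) = if δ i then 1 else -1 := by
  rw [gridSign, gridPoint_div hu]
  cases δ i <;> simp

theorem cornerSign_mul_gridValue {u : Bool → Fin (D + 1) → ℕ} (hu : ∀ β i, u β i ≤ N)
    (δ : Fin (D + 1) → Bool) :
    cornerSign δ * gridValue N E (gridPoint N u δ) = weight N E (gridPoint N u δ) := by
  rw [gridValue, ← mul_assoc, cornerSign, ← Finset.prod_mul_distrib]
  simp only [gridSign_gridPoint hu]
  rw [Finset.prod_eq_one fun i _ => by cases δ i <;> simp, one_mul]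

/-- Triples in three distinct directions are seen by some corner through `cross`. Triples with both
ends of one direction are seen through `outlier`, once the constant corners have established both
checksums. -/
theorem forall_consistent_iff (symm₁ : ∀ x y z, E x y z → E y x z)
    (symm₂ : ∀ x y z, E x y z → E x z y) {u : Bool → Fin (D + 1) → ℕ} (hu : ∀ β i, u β i < N) :
    (∀ δ, Consistent N E (gridPoint N u δ)) ↔
      (∀ β, (∑ i, u β i) % N = 0) ∧ IsCliqueFamily E fun p => u p.2 p.1.castSucc := by
  have hu' : ∀ β i, u β i ≤ N := fun β i => (hu β i).le
  constructor
  · intro h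
    have hsum : ∀ β, (∑ i, u β i) % N = 0 := by
      intro β
      have := (h fun _ => β).checksum fun i j => by rw [gridPoint_div hu', gridPoint_div hu']
      simpa only [gridPoint_mod hu'] using this
    refine ⟨hsum, ?_⟩
    have pair : ∀ (i j : Fin D) (β : Bool), i ≠ j →
        E (u (!β) i.castSucc) (u β i.castSucc) (u (!β) j.castSucc) := by
      intro i j β hij
      have hji : j.castSucc ≠ i.castSucc := fun e => hij (Fin.castSucc_injective _ e).symm
      -- Every direction except `i` shows the kind `!β`, so the checksum of that kind reveals the
      -- hidden value `u (!β) i.castSucc`.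
      have := (h fun k => if k = i.castSucc then β else !β).outlier i j hij (by
        intro k hk
        rw [gridPoint_div hu', gridPoint_div hu', if_neg hk, if_pos rfl]
        cases β <;> simp)
      simp only [gridPoint_mod hu', if_true, if_neg hji, Nat.mod_eq_of_lt (hu _ _)] at this
      rwa [complement_congr (v' := u (!β)) (fun k hk => by rw [if_neg hk]),
        complement_eq (hu _) (hsum _)] at this
    have pair' : ∀ (i j : Fin D) (β γ : Bool), i ≠ j →
        E (u β i.castSucc) (u (!β) i.castSucc) (u γ j.castSucc) := by
      intro i j β γ hij
      rcases Bool.eq_or_eq_not γ β with rfl | rfl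
      · simpa using pair i j (!γ) hij
      · exact symm₁ _ _ _ (pair i j β hij)
    rintro ⟨i, β⟩ ⟨j, γ⟩ ⟨k, ε⟩ h₁ h₂ h₃
    simp only
    have flip : ∀ {i : Fin D} {β γ : Bool}, (i, β) ≠ (i, γ) → γ = !β := by
      intro i β γ hne
      cases β <;> cases γ <;> simp_all
    by_cases hij : i = j
    · subst hij
      obtain rfl := flip h₁
      refine pair' i k β ε ?_
      rintro rfl
      cases β <;> cases ε <;> simp_all
    by_cases hik : i = k
    · subst hik
      obtain rfl := flip h₂
      exact symm₂ _ _ _ (pair' i j β γ hij)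
    by_cases hjk : j = k
    · subst hjk
      obtain rfl := flip h₃
      exact symm₁ _ _ _ (symm₂ _ _ _ (pair' j i γ β (Ne.symm hij)))
    have hcs : ∀ {i j : Fin D}, i ≠ j → i.castSucc ≠ j.castSucc :=
      fun h e => h (Fin.castSucc_injective _ e)
    have := (h fun l => if l = i.castSucc then β else if l = j.castSucc then γ else ε).cross
      i j k hij hik hjk
    simpa only [gridPoint_mod hu', if_true, if_neg (hcs (Ne.symm hij)),
      if_neg (hcs (Ne.symm hik)), if_neg (hcs (Ne.symm hjk)), Nat.mod_eq_of_lt (hu _ _)] using this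
  · rintro ⟨hsum, hcl⟩ δ
    refine ⟨fun h => ?_, fun i j k hij hik hjk => ?_, fun i j hij h => ?_⟩
    · simp only [gridPoint_div hu'] at h
      simp only [gridPoint_mod hu']
      have : ∀ i, δ i = δ 0 := by
        intro i
        have := h i 0
        revert this
        cases δ i <;> cases δ 0 <;> simp
      simp only [this, hsum]
    · simp only [gridPoint_mod hu', Nat.mod_eq_of_lt (hu _ _)]
      exact hcl (i, _) (j, _) (k, _) (fun e => hij (congrArg Prod.fst e))
        (fun e => hik (congrArg Prod.fst e)) (fun e => hjk (congrArg Prod.fst e))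
    · simp only [gridPoint_div hu'] at h
      simp only [gridPoint_mod hu', Nat.mod_eq_of_lt (hu _ _)]
      have hflip : ∀ k, k ≠ i.castSucc → δ k = !δ i.castSucc := by
        intro k hk
        have := h k hk
        revert this
        cases δ k <;> cases δ i.castSucc <;> simp
      rw [complement_congr (v' := u (!δ i.castSucc)) (fun k hk => by rw [hflip k hk]),
        complement_eq (hu _) (hsum _)]
      exact hcl (i, _) (i, _) (j, _) (fun e => Bool.not_ne_self _ (congrArg Prod.snd e)) (fun e => hij (congrArg Prod.fst e))
        (fun e => hij (congrArg Prod.fst e))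

/-! ### Boxes whose sum is within one of the upper bound -/

theorem weight_le_two (c : Fin (D + 1) → ℕ) : weight N E c ≤ 2 := by
  unfold weight
  split_ifs with h₁ h₂ h₃ h₃ <;> try omega
  all_goals exact absurd (h₁ 0) (h₃.1 0)

theorem abs_gridSign_le (c : ℕ) : |gridSign N c| ≤ 1 := by
  unfold gridSign
  split_ifs <;> simp

theorem abs_cornerSign {d : ℕ} (δ : Fin d → Bool) : |cornerSign δ| = 1 := by
  rw [cornerSign, Finset.abs_prod]
  exact Finset.prod_eq_one fun i _ => by split_ifs <;> simp

theorem abs_gridValue_le (c : Fin (D + 1) → ℕ) : |gridValue N E c| ≤ 2 := by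
  rw [gridValue, abs_mul, Finset.abs_prod]
  have h₁ : ∏ i, |gridSign N (c i)| ≤ 1 :=
    Finset.prod_le_one (fun _ _ => abs_nonneg _) fun i _ => abs_gridSign_le _
  have h₂ : |(weight N E c : ℤ)| ≤ 2 := by
    rw [Nat.abs_cast]
    exact_mod_cast weight_le_two c
  calc _ ≤ 1 * (2 : ℤ) := mul_le_mul h₁ h₂ (abs_nonneg _) zero_le_one
    _ = 2 := one_mul _

theorem abs_mul_gridValue_le (δ : Fin (D + 1) → Bool) (c : Fin (D + 1) → ℕ) :
    |cornerSign δ * gridValue N E c| ≤ 2 := by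
  rw [abs_mul, abs_cornerSign, one_mul]
  exact abs_gridValue_le c

theorem abs_mixedDiff_gridValue_le (x : Fin (D + 1) → ℕ) :
    |mixedDiff (gridValue N E) x| ≤ 2 ^ (D + 2) := by
  unfold mixedDiff
  refine (Finset.abs_sum_le_sum_abs _ _).trans ?_
  refine (Finset.sum_le_sum fun δ _ => abs_mul_gridValue_le δ _).trans_eq ?_
  simp [pow_succ]

theorem boxSum_eq_sum_weight {u : Bool → Fin (D + 1) → ℕ} (hu : ∀ β i, u β i ≤ N)
    {L R : Fin (D + 1) → ℕ} (hL : ∀ i, L i = u false i) (hR : ∀ i, R i = u true i + (N + 1)) :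
    boxSum N E L R = ∑ δ : Fin (D + 1) → Bool, (weight N E (gridPoint N u δ) : ℤ) := by
  refine Finset.sum_congr rfl fun δ _ => ?_
  rw [← cornerSign_mul_gridValue hu]
  congr 2
  funext i
  rw [corner, gridPoint, hL, hR]
  cases δ i <;> simp

theorem exists_boxSum_eq_of_isCliqueFamily (symm₁ : ∀ x y z, E x y z → E y x z)
    (symm₂ : ∀ x y z, E x y z → E x z y) (f : Fin D × Bool → ℕ) (hf : ∀ p, f p < N)
    (hN : 0 < N) (h : IsCliqueFamily E f) :
    ∃ L R : Fin (D + 1) → ℕ, (∀ i, L i < R i) ∧ (∀ i, R i ≤ 2 * N + 1) ∧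
      boxSum N E L R = 2 ^ (D + 2) := by
  -- The last coordinate is chosen to complete the checksum for each kind of end.
  let u : Bool → Fin (D + 1) → ℕ := fun β =>
    Fin.snoc (α := fun _ => ℕ) (fun i => f (i, β)) ((∑ i, (N - f (i, β))) % N)
  have hu : ∀ β i, u β i < N := by
    intro β i
    refine Fin.lastCases ?_ (fun i => ?_) i
    · simpa [u] using Nat.mod_lt _ hN
    · simpa [u] using hf _
  have hu' : ∀ β i, u β i ≤ N := fun β i => (hu β i).le
  have hsum : ∀ β, (∑ i, u β i) % N = 0 := by
    intro β
    rw [Fin.sum_univ_castSucc]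
    simp only [u, Fin.snoc_castSucc, Fin.snoc_last]
    rw [Nat.add_mod_mod, ← Finset.sum_add_distrib,
      Finset.sum_congr rfl fun i _ => Nat.add_sub_cancel' (hf (i, β)).le]
    simp
  have hc := (forall_consistent_iff symm₁ symm₂ hu).2 ⟨hsum, by simpa [u] using h⟩
  refine ⟨u false, fun i => u true i + (N + 1), fun i => ?_, fun i => ?_, ?_⟩
  · have := hu false i
    simp only
    omega
  · have := hu true i
    simp only
    omega
  · rw [boxSum_eq_sum_weight hu' (fun _ => rfl) (fun _ => rfl)]
    have : ∀ δ, weight N E (gridPoint N u δ) = 2 := by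
      intro δ
      have hne : ∀ i, gridPoint N u δ i % (N + 1) ≠ N := by
        intro i
        rw [gridPoint_mod hu']
        exact (hu _ _).ne
      rw [weight, if_neg fun h => hne 0 (h 0), if_pos ⟨hne, hc δ⟩]
    simp [this, pow_succ]

theorem boxSum_dummy : boxSum N E (fun _ : Fin (D + 1) => N) (fun _ => 2 * N + 1) =
    2 ^ (D + 2) - 1 := by
  have hu : ∀ (β : Bool) (i : Fin (D + 1)), (fun _ _ => N : Bool → Fin (D + 1) → ℕ) β i ≤ N :=
    fun _ _ => le_rfl
  rw [boxSum_eq_sum_weight hu (fun _ => rfl) (fun _ => by omega)]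
  have : ∀ δ : Fin (D + 1) → Bool, (weight N E (gridPoint N (fun _ _ => N) δ) : ℤ) =
      2 - if δ = fun _ => false then 1 else 0 := by
    intro δ
    have hv : ∀ i, gridPoint N (fun _ _ => N) δ i % (N + 1) = N := gridPoint_mod hu δ
    have hq := gridPoint_div hu δ
    have hc : ¬((∀ i, gridPoint N (fun _ _ => N) δ i % (N + 1) ≠ N) ∧
        Consistent N E (gridPoint N (fun _ _ => N) δ)) := fun h => h.1 0 (hv 0)
    rw [weight, if_pos hv, if_neg hc]
    by_cases h : δ = fun _ => false
    · rw [if_pos h, if_pos fun i => by rw [hq, h]; rfl]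
      rfl
    · rw [if_neg h, if_neg]
      · rfl
      · intro h'
        refine h (funext fun i => ?_)
        have := h' i
        rw [hq] at this
        revert this
        cases δ i <;> simp
  rw [Finset.sum_congr rfl fun δ _ => this δ, Finset.sum_sub_distrib]
  simp [pow_succ]

/-- Each of the 2^(D+1) corners contributes at most 2, and the total deficit is at most 1, so no
single corner can lose more than 1. -/
theorem one_le_of_le_boxSum {L R : Fin (D + 1) → ℕ} (h : 2 ^ (D + 2) - 1 ≤ boxSum N E L R)
    (δ : Fin (D + 1) → Bool) : 1 ≤ cornerSign δ * gridValue N E (corner L R δ) := by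
  have h₁ : ∀ δ : Fin (D + 1) → Bool, 0 ≤ 2 - cornerSign δ * gridValue N E (corner L R δ) :=
    fun δ => sub_nonneg.2 (le_of_abs_le (abs_mul_gridValue_le δ _))
  have h₂ := Finset.single_le_sum (fun δ _ => h₁ δ) (Finset.mem_univ δ)
  rw [Finset.sum_sub_distrib] at h₂
  have h₃ : ∑ _δ : Fin (D + 1) → Bool, (2 : ℤ) = 2 ^ (D + 2) := by simp [pow_succ]
  rw [h₃] at h₂
  unfold boxSum at h
  linarith

/-- Two corners differing only in direction `i` share all other sign factors. Positivity at both,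
with opposite corner signs, forces opposite grid signs at `L i` and `R i`. -/
theorem gridSign_of_one_le {L R : Fin (D + 1) → ℕ}
    (h : ∀ δ, 1 ≤ cornerSign δ * gridValue N E (corner L R δ)) (i : Fin (D + 1)) :
    gridSign N (L i) * gridSign N (R i) < 0 := by
  have key : ∀ β : Bool, 0 < (if β then (1 : ℤ) else -1) *
      gridSign N (if β then R i else L i) *
      ∏ j ∈ Finset.univ.erase i, (-1 * gridSign N (L j)) := by
    intro β
    have h₁ := h (Function.update (fun _ => false) i β)
    rw [gridValue, cornerSign, ← mul_assoc, ← Finset.prod_mul_distrib,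
      ← Finset.mul_prod_erase _ _ (Finset.mem_univ i)] at h₁
    rw [Finset.prod_congr rfl (g := fun j => -1 * gridSign N (L j)) fun j hj => by
      simp [corner, Finset.ne_of_mem_erase hj]] at h₁
    simp only [corner, Function.update_self] at h₁
    exact pos_of_mul_pos_left (zero_lt_one.trans_le h₁) (Nat.cast_nonneg _)
  have h₀ := key false
  have h₁ := key true
  simp only [Bool.false_eq_true, if_false, if_true, one_mul] at h₀ h₁
  nlinarith [mul_pos h₀ h₁, sq_nonneg (∏ j ∈ Finset.univ.erase i, (-1 * gridSign N (L j)))]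

theorem ends_of_le_boxSum {L R : Fin (D + 1) → ℕ} (hLR : ∀ i, L i < R i)
    (h : 2 ^ (D + 2) - 1 ≤ boxSum N E L R) (i : Fin (D + 1)) :
    L i ≤ N ∧ N + 1 ≤ R i ∧ R i ≤ 2 * N + 1 := by
  have h₁ := gridSign_of_one_le (one_le_of_le_boxSum h) i
  have hdiv : L i / (N + 1) ≤ R i / (N + 1) := Nat.div_le_div_right (hLR i).le
  unfold gridSign at h₁
  have : L i / (N + 1) = 0 ∧ R i / (N + 1) = 1 := by
    split_ifs at h₁ <;> omega
  obtain ⟨e₁, e₂⟩ := this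
  rw [Nat.div_eq_iff N.succ_pos] at e₁ e₂
  omega

theorem of_le_boxSum (hD : 0 < D) (symm₁ : ∀ x y z, E x y z → E y x z)
    (symm₂ : ∀ x y z, E x y z → E x z y) {L R : Fin (D + 1) → ℕ} (hLR : ∀ i, L i < R i)
    (h : 2 ^ (D + 2) - 1 ≤ boxSum N E L R) :
    (L 0 = N → boxSum N E L R < 2 ^ (D + 2)) ∧ (L 0 ≠ N →
      (∀ i, L i < N ∧ N + 1 ≤ R i ∧ R i ≤ 2 * N) ∧ IsCliqueFamily (D := D) E
        fun p => if p.2 then R p.1.castSucc - (N + 1) else L p.1.castSucc) := by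
  have ends := ends_of_le_boxSum hLR h
  let u : Bool → Fin (D + 1) → ℕ := fun β i => if β then R i - (N + 1) else L i
  have hu : ∀ β i, u β i ≤ N := by
    intro β i
    have := ends i
    cases β <;> simp only [u, if_true, Bool.false_eq_true, if_false] <;> omega
  have hL : ∀ i, L i = u false i := fun i => rfl
  have hR : ∀ i, R i = u true i + (N + 1) := fun i => (Nat.sub_add_cancel (ends i).2.1).symm
  have hcorner : ∀ δ, corner L R δ = gridPoint N u δ := by
    intro δ
    funext i
    rw [corner, gridPoint, hL, hR]
    cases δ i <;> simp
  have hw : ∀ δ, 1 ≤ weight N E (gridPoint N u δ) := by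
    intro δ
    have := one_le_of_le_boxSum h δ
    rw [hcorner, cornerSign_mul_gridValue hu] at this
    exact_mod_cast this
  constructor
  · intro h0
    rw [boxSum_eq_sum_weight hu hL hR]
    have : ∑ _δ : Fin (D + 1) → Bool, (2 : ℤ) = 2 ^ (D + 2) := by simp [pow_succ]
    rw [← this]
    refine Finset.sum_lt_sum (fun δ _ => by exact_mod_cast weight_le_two _)
      ⟨fun _ => false, Finset.mem_univ _, ?_⟩
    -- A dummy at `L 0` excludes the consistency weight at the all-lower corner, and the dummy
    -- weight there is only 1. The upper bound is thus missed.
    have hq : ∀ i, gridPoint N u (fun _ => false) i / (N + 1) = 0 := gridPoint_div hu _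
    have hv : gridPoint N u (fun _ => false) 0 % (N + 1) = N := (gridPoint_mod hu _ _).trans h0
    have hc : ¬((∀ i, gridPoint N u (fun _ => false) i % (N + 1) ≠ N) ∧
        Consistent N E (gridPoint N u fun _ => false)) := fun h => h.1 0 hv
    rw [weight, if_neg hc, if_pos hq]
    split_ifs <;> simp
  · intro h0
    -- Positive weight means all dummy or no dummy, so one proper value at a corner makes the whole
    -- corner proper and consistent.
    have of_ne : ∀ δ i, u (δ i) i ≠ N →
        (∀ j, u (δ j) j ≠ N) ∧ Consistent N E (gridPoint N u δ) := by
      intro δ i hi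
      have := hw δ
      have hd : ¬∀ i, gridPoint N u δ i % (N + 1) = N := fun h =>
        hi (by rw [← gridPoint_mod hu, h i])
      rw [weight, if_neg hd] at this
      by_contra hcon
      have hc : ¬((∀ i, gridPoint N u δ i % (N + 1) ≠ N) ∧
          Consistent N E (gridPoint N u δ)) := fun h =>
        hcon ⟨fun j => gridPoint_mod hu δ j ▸ h.1 j, h.2⟩
      rw [if_neg hc] at this
      omega
    -- No corner contains both `L 0` and `R 0`; properness passes from one to the other through the
    -- lower end in direction 1, which exists because `0 < D`.
    have h1 : (⟨1, by omega⟩ : Fin (D + 1)) ≠ 0 := by simp [Fin.ext_iff]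
    have hL1 : u false ⟨1, by omega⟩ ≠ N := (of_ne (fun _ => false) 0 h0).1 _
    have hne : ∀ β i, u β i ≠ N := by
      intro β i
      by_cases hi : i = 0
      · subst hi
        have := (of_ne (fun j => if j = 0 then β else false) ⟨1, by omega⟩ (by
          rwa [if_neg h1])).1 0
        simpa using this
      · have := (of_ne (fun j => if j = 0 then false else β) 0 h0).1 i
        simpa [hi] using this
    have hu' : ∀ β i, u β i < N := fun β i => lt_of_le_of_ne (hu β i) (hne β i)
    refine ⟨fun i => ⟨hu' false i, (ends i).2.1, ?_⟩,
      ((forall_consistent_iff symm₁ symm₂ hu').1 fun δ => (of_ne δ 0 (hne _ _)).2).2⟩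
    have := hu' true i
    have := hR i
    omega

end CliqueArray

/-! ### Numerical and logical values of expressions -/

namespace WordRAM

namespace Expr

/-- The sum of finitely many expressions. -/
noncomputable def sum {ι : Type*} (s : Finset ι) (f : ι → Expr) : Expr :=
  (s.toList.map f).foldr (op .add) (const 0)

/-- The product of finitely many expressions. -/
noncomputable def prod {ι : Type*} (s : Finset ι) (f : ι → Expr) : Expr :=
  (s.toList.map f).foldr (op .mul) (const 1)

/-- Powers with a fixed exponent. -/
def pow (e : Expr) : ℕ → Expr
  | 0 => const 1
  | k + 1 => op .mul (pow e k) e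

/-- Negation of truth values. -/
def not (e : Expr) : Expr := op .eq e (const 0)

/-- Conjunction of truth values. -/
def and (e f : Expr) : Expr := op .mul e f

/-- Implication of truth values. -/
def imp (e f : Expr) : Expr := not (and e (not f))

variable {w : ℕ} {σ : State w}

theorem eval_sum {ι : Type*} (s : Finset ι) (f : ι → Expr) :
    (sum s f).eval σ = ∑ i ∈ s, (f i).eval σ := by
  rw [← Finset.sum_map_toList, sum]
  induction s.toList with
  | nil => rfl
  | cons a l ih =>
    simp only [List.map_cons, List.foldr_cons, List.sum_cons, eval, BinOp.eval, ih]

theorem eval_prod {ι : Type*} (s : Finset ι) (f : ι → Expr) :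
    (prod s f).eval σ = ∏ i ∈ s, (f i).eval σ := by
  rw [← Finset.prod_map_toList, prod]
  induction s.toList with
  | nil => rfl
  | cons a l ih =>
    simp only [List.map_cons, List.foldr_cons, List.prod_cons, eval, BinOp.eval, ih]

/-- The value of `e` is the number `k`. -/
def Num (σ : State w) (e : Expr) (k : ℕ) : Prop := (e.eval σ).toNat = k

open scoped Classical in
/-- The value of `e` is the truth value of `P`. -/
def Truth (σ : State w) (e : Expr) (P : Prop) : Prop := e.eval σ = if P then 1 else 0

theorem Truth.of_iff {e : Expr} {P Q : Prop} (he : Truth σ e P) (h : P ↔ Q) : Truth σ e Q :=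
  propext h ▸ he

theorem Num.eval_eq {e : Expr} {k : ℕ} (h : Num σ e k) : e.eval σ = BitVec.ofNat w k := by
  unfold Num at h
  rw [← h, BitVec.ofNat_toNat, BitVec.setWidth_eq]

theorem num_const {c : ℕ} (h : c < 2 ^ w) : Num σ (const c) c := by
  rw [Num, eval, BitVec.toNat_ofNat, Nat.mod_eq_of_lt h]

theorem Num.add {e f : Expr} {k l : ℕ} (he : Num σ e k) (hf : Num σ f l) (h : k + l < 2 ^ w) :
    Num σ (op .add e f) (k + l) := by
  unfold Num at *
  rw [eval, BinOp.eval, BitVec.toNat_add_of_lt (by omega), he, hf]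

theorem Num.sub {e f : Expr} {k l : ℕ} (he : Num σ e k) (hf : Num σ f l) (h : l ≤ k) :
    Num σ (op .sub e f) (k - l) := by
  unfold Num at *
  rw [eval, BinOp.eval, BitVec.toNat_sub_of_le (by rw [BitVec.le_def]; omega), he, hf]

theorem Num.mul {e f : Expr} {k l : ℕ} (he : Num σ e k) (hf : Num σ f l) (h : k * l < 2 ^ w) :
    Num σ (op .mul e f) (k * l) := by
  unfold Num at *
  rw [eval, BinOp.eval, BitVec.toNat_mul, he, hf, Nat.mod_eq_of_lt h]

theorem Num.div {e f : Expr} {k l : ℕ} (he : Num σ e k) (hf : Num σ f l) :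
    Num σ (op .div e f) (k / l) := by
  unfold Num at *
  rw [eval, BinOp.eval, BitVec.toNat_udiv, he, hf]

theorem Num.mod {e f : Expr} {k l : ℕ} (he : Num σ e k) (hf : Num σ f l) :
    Num σ (op .mod e f) (k % l) := by
  unfold Num at *
  rw [eval, BinOp.eval, BitVec.toNat_umod, he, hf]

theorem Num.sum {ι : Type*} {s : Finset ι} {f : ι → Expr} {k : ι → ℕ}
    (hf : ∀ i ∈ s, Num σ (f i) (k i)) (h : ∑ i ∈ s, k i < 2 ^ w) :
    Num σ (Expr.sum s f) (∑ i ∈ s, k i) := by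
  have : (Expr.sum s f).eval σ = BitVec.ofNat w (∑ i ∈ s, k i) := by
    rw [eval_sum, Finset.sum_congr rfl fun i hi => (hf i hi).eval_eq]
    exact (Nat.cast_sum (R := BitVec w) s k).symm
  rw [Num, this, BitVec.toNat_ofNat, Nat.mod_eq_of_lt h]

theorem Num.pow {e : Expr} {k : ℕ} (he : Num σ e k) (m : ℕ) (hk : 0 < k) (h : k ^ m < 2 ^ w) :
    Num σ (e.pow m) (k ^ m) := by
  induction m with
  | zero => exact num_const (by simpa using h)
  | succ m ih =>
    exact (ih ((Nat.pow_le_pow_right hk (Nat.le_succ m)).trans_lt h)).mul he h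

theorem Num.eq {e f : Expr} {k l : ℕ} (he : Num σ e k) (hf : Num σ f l) :
    Truth σ (op .eq e f) (k = l) := by
  unfold Num at *
  unfold Truth
  rw [eval, BinOp.eval]
  subst he hf
  simp only [BitVec.toNat_inj]
  rfl

theorem Truth.and {e f : Expr} {P Q : Prop} (he : Truth σ e P) (hf : Truth σ f Q) :
    Truth σ (e.and f) (P ∧ Q) := by
  unfold Truth at *
  rw [Expr.and, eval, he, hf, BinOp.eval]
  by_cases P <;> by_cases Q <;> simp [*]

theorem Truth.not (hw : 0 < w) {e : Expr} {P : Prop} (he : Truth σ e P) :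
    Truth σ e.not (¬P) := by
  unfold Truth at *
  have h1 : (1 : BitVec w) ≠ 0 := by
    intro h
    have := congrArg BitVec.toNat h
    simp [Nat.mod_eq_of_lt (Nat.one_lt_two_pow hw.ne')] at this
  rw [Expr.not, eval, he, BinOp.eval, eval]
  by_cases P <;> simp_all

theorem Truth.imp (hw : 0 < w) {e f : Expr} {P Q : Prop} (he : Truth σ e P)
    (hf : Truth σ f Q) : Truth σ (e.imp f) (P → Q) := by
  have := (he.and (hf.not hw)).not hw
  exact this.of_iff (by tauto)

theorem Truth.prod {ι : Type*} {s : Finset ι} {f : ι → Expr} {P : ι → Prop}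
    (hf : ∀ i ∈ s, Truth σ (f i) (P i)) : Truth σ (Expr.prod s f) (∀ i ∈ s, P i) := by
  classical
  unfold Truth at *
  rw [eval_prod, Finset.prod_congr rfl hf, Finset.prod_ite_zero, Finset.prod_const_one]
  congr

end Expr

end WordRAM

namespace CliqueArray

open WordRAM Expr

/-! ### Computing the entries of the array

The register `r` holds the number `N` of vertices; the array has side length `8 * N`. -/

/-- The side length. -/
def sideExpr (r : ℕ) : Expr := op .mul (const 8) (reg r)

/-- The number of entries in one half of the array. -/
def halfExpr (D r : ℕ) : Expr := op .mul (op .mul (const 4) (reg r)) ((sideExpr r).pow D)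

/-- The entry of the copy of the adjacency tensor in the upper half of the memory. -/
def tensorExpr (D r : ℕ) (e f g : Expr) : Expr :=
  load (op .add (op .add (halfExpr D r) (const 1))
    (op .add (op .add e (op .mul f (reg r))) (op .mul g (op .mul (reg r) (reg r)))))

/-- The `i`-th coordinate of the position in the register `s`, shifted according to `b`. -/
def coordExpr (r s i : ℕ) (b : Bool) : Expr :=
  op .add (op .mod (op .div (reg s) ((sideExpr r).pow i)) (sideExpr r)) (const b.toNat)

/-- The successor of the number of vertices. -/
def succExpr (r : ℕ) : Expr := op .add (reg r) (const 1)

/-- The test of `Consistent`. -/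
noncomputable def consistentExpr (D r : ℕ) (c : Fin (D + 1) → Expr) : Expr :=
  let q := fun i => op .div (c i) (succExpr r)
  let v := fun i => op .mod (c i) (succExpr r)
  let x := fun i : Fin D => op .mod (v i.castSucc) (reg r)
  and (imp (prod Finset.univ fun i => prod Finset.univ fun j => op .eq (q i) (q j))
      (op .eq (op .mod (sum Finset.univ v) (reg r)) (const 0)))
    (and (prod {p : Fin D × Fin D × Fin D | p.1 ≠ p.2.1 ∧ p.1 ≠ p.2.2 ∧ p.2.1 ≠ p.2.2} fun p =>
        tensorExpr D r (x p.1) (x p.2.1) (x p.2.2))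
      (prod {p : Fin D × Fin D | p.1 ≠ p.2} fun p =>
        imp (prod (Finset.univ.erase p.1.castSucc) fun k => not (op .eq (q k) (q p.1.castSucc)))
          (tensorExpr D r (op .mod (sum (Finset.univ.erase p.1.castSucc) fun j =>
            op .sub (reg r) (v j)) (reg r)) (x p.1) (x p.2))))

/-- The value of `gridValue`. -/
noncomputable def gridValueExpr (D r : ℕ) (c : Fin (D + 1) → Expr) : Expr :=
  let q := fun i => op .div (c i) (succExpr r)
  let v := fun i => op .mod (c i) (succExpr r)
  op .mul (prod Finset.univ fun i =>
      op .sub (op .eq (q i) (const 1)) (op .eq (q i) (const 0)))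
    (op .add
      (op .mul (prod Finset.univ fun i => op .eq (v i) (reg r))
        (op .sub (const 2) (prod Finset.univ fun i => op .eq (q i) (const 0))))
      (op .mul (const 2) (and (prod Finset.univ fun i => not (op .eq (v i) (reg r)))
        (consistentExpr D r c))))

/-- The sign of a corner. -/
noncomputable def cornerSignExpr {d : ℕ} (δ : Fin d → Bool) : Expr :=
  prod Finset.univ fun i => if δ i then const 1 else op .sub (const 0) (const 1)

/-- The entry of the array at the position in the register `s`. -/
noncomputable def entryExpr (D r s : ℕ) : Expr :=
  sum Finset.univ fun δ : Fin (D + 1) → Bool =>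
    op .mul (cornerSignExpr δ) (gridValueExpr D r fun i => coordExpr r s i (δ i))

/-- The state holds the number of vertices in register `r`, and the array fits into the memory. -/
structure HasSize {w : ℕ} (N D r : ℕ) (σ : State w) : Prop where
  pos : 0 < N
  two_le : 2 ≤ D
  lt : (8 * N) ^ (D + 1) < 2 ^ w
  num : Num σ (reg r) N

open scoped Classical in
/-- In addition, the state holds the adjacency tensor in the upper half of the memory. -/
structure HasTensor {w : ℕ} (N D r : ℕ) (E : ℕ → ℕ → ℕ → Prop) (σ : State w) : Prop
    extends HasSize N D r σ where
  tensor : ∀ a b c, a < N → b < N → c < N →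
    σ.mem (BitVec.ofNat w (4 * N * (8 * N) ^ D + 1 + (a + b * N + c * (N * N)))) =
      if E a b c then 1 else 0

/-- This is the room needed to park the adjacency tensor in half of the array; it uses `2 ≤ D`. -/
theorem cube_le_half {N D : ℕ} (hN : 0 < N) (hD : 2 ≤ D) : N * N * N ≤ 4 * N * (8 * N) ^ D := by
  have h : (8 * N) ^ 2 ≤ (8 * N) ^ D := Nat.pow_le_pow_right (by omega) hD
  have h₁ : N * N ≤ (8 * N) ^ D := by nlinarith
  calc N * N * N = N * (N * N) := by ring
    _ ≤ 4 * N * (8 * N) ^ D := Nat.mul_le_mul (by omega) h₁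

theorem two_mul_half (N D : ℕ) : 2 * (4 * N * (8 * N) ^ D) = (8 * N) ^ (D + 1) := by ring

variable {w N D r : ℕ} {E : ℕ → ℕ → ℕ → Prop} {σ : State w}

theorem tensor_index_lt {a b c : ℕ} (ha : a < N) (hb : b < N) (hc : c < N) :
    a + b * N + c * (N * N) < N * N * N := by
  have h₁ : a + b * N < N * N := by nlinarith
  nlinarith

namespace HasSize

theorem eight_le (h : HasSize N D r σ) : 8 * N < 2 ^ w := by
  have := h.pos
  exact (Nat.le_self_pow (Nat.succ_ne_zero D) _).trans_lt h.lt

theorem width_pos (h : HasSize N D r σ) : 0 < w := by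
  have h₁ := h.eight_le
  have h₂ := h.pos
  rcases Nat.eq_zero_or_pos w with rfl | hw
  · simp at h₁
    omega
  · exact hw

theorem side (h : HasSize N D r σ) : Num σ (sideExpr r) (8 * N) := by
  have := h.pos
  have := h.eight_le
  exact (num_const (by omega)).mul h.num this

theorem succ (h : HasSize N D r σ) : Num σ (succExpr r) (N + 1) := by
  have := h.pos
  have := h.eight_le
  exact h.num.add (num_const (by omega)) (by omega)

theorem half (h : HasSize N D r σ) : Num σ (halfExpr D r) (4 * N * (8 * N) ^ D) := by
  have h₁ := h.pos
  have h₂ := h.eight_le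
  have h₃ := h.lt
  have h₄ := two_mul_half N D
  exact ((num_const (by omega)).mul h.num (by omega)).mul
    (h.side.pow D (by omega)
      ((Nat.pow_le_pow_right (by omega) (Nat.le_succ D)).trans_lt h.lt)) (by omega)

end HasSize

namespace HasTensor

theorem truth_tensor (h : HasTensor N D r E σ) {e f g : Expr} {a b c : ℕ} (ha : a < N)
    (hb : b < N) (hc : c < N) (he : Num σ e a) (hf : Num σ f b) (hg : Num σ g c) :
    Truth σ (tensorExpr D r e f g) (E a b c) := by
  have h₁ := h.lt
  have h₂ := two_mul_half N D
  have h₃ := cube_le_half h.pos h.two_le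
  have h₄ := tensor_index_lt ha hb hc
  have h₅ : N * N ≤ N * N * N := Nat.le_mul_of_pos_right _ h.pos
  have key := (h.half.add (num_const (σ := σ) (c := 1) (by omega)) (by omega)).add
    ((he.add (hf.mul h.num (by omega)) (by omega)).add
      (hg.mul (h.num.mul h.num (by omega)) (by omega)) (by omega)) (by omega)
  rw [Truth, tensorExpr, eval, key.eval_eq]
  exact h.tensor a b c ha hb hc

theorem sum_lt (h : HasTensor N D r E σ) {s : Finset (Fin (D + 1))} {k : Fin (D + 1) → ℕ}
    (hk : ∀ i, k i ≤ N) : ∑ i ∈ s, k i < 2 ^ w := by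
  refine lt_of_le_of_lt ?_ h.lt
  calc ∑ i ∈ s, k i ≤ s.card * N := by
        simpa using Finset.sum_le_card_nsmul s k N fun i _ => hk i
    _ ≤ (D + 1) * N := Nat.mul_le_mul_right _ (by simpa using s.card_le_univ)
    _ ≤ 8 ^ (D + 1) * N ^ (D + 1) := Nat.mul_le_mul (Nat.lt_pow_self (by norm_num)).le
        (Nat.le_self_pow (Nat.succ_ne_zero D) _)
    _ = (8 * N) ^ (D + 1) := (mul_pow _ _ _).symm

theorem truth_consistent (h : HasTensor N D r E σ) {e : Fin (D + 1) → Expr}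
    {c : Fin (D + 1) → ℕ} (he : ∀ i, Num σ (e i) (c i)) :
    Truth σ (consistentExpr D r e) (Consistent N E c) := by
  have hw := h.width_pos
  have q := fun i => (he i).div h.succ
  have v := fun i => (he i).mod h.succ
  have x := fun i : Fin D => (v i.castSucc).mod h.num
  -- The test is evaluated without branching, even at dummy coordinates. The extra reduction modulo
  -- `N` keeps every tensor lookup in range and does not alter proper values.
  have hx : ∀ a, a % N < N := fun a => Nat.mod_lt a h.pos
  have hv : ∀ i, c i % (N + 1) ≤ N := fun i => Nat.le_of_lt_succ (Nat.mod_lt _ N.succ_pos)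
  have t₁ := (Truth.prod (s := Finset.univ) fun i _ => Truth.prod (s := Finset.univ) fun j _ =>
    (q i).eq (q j)).imp hw (((Num.sum (s := Finset.univ) (fun i _ => v i) (h.sum_lt hv)).mod
      h.num).eq (num_const (σ := σ) (Nat.two_pow_pos w)))
  have t₂ := Truth.prod
    (s := {p : Fin D × Fin D × Fin D | p.1 ≠ p.2.1 ∧ p.1 ≠ p.2.2 ∧ p.2.1 ≠ p.2.2})
    fun p _ => h.truth_tensor (hx _) (hx _) (hx _) (x p.1) (x p.2.1) (x p.2.2)
  have t₃ := Truth.prod (s := {p : Fin D × Fin D | p.1 ≠ p.2}) fun p _ =>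
    (Truth.prod (s := Finset.univ.erase p.1.castSucc) fun k _ =>
      ((q k).eq (q p.1.castSucc)).not hw).imp hw (h.truth_tensor (hx _) (hx _) (hx _)
        ((Num.sum (s := Finset.univ.erase p.1.castSucc) (fun j _ => h.num.sub (v j) (hv j))
          (h.sum_lt fun j => Nat.sub_le _ _)).mod h.num) (x p.1) (x p.2))
  refine (t₁.and (t₂.and t₃)).of_iff ?_
  constructor
  · rintro ⟨h₁, h₂, h₃⟩
    refine ⟨fun hq => h₁ fun i _ j _ => hq i j, fun i j k hij hik hjk => h₂ (i, j, k) (by simp [*]),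
      fun i j hij hq => h₃ (i, j) (by simp [hij]) fun k hk => hq k (Finset.ne_of_mem_erase hk)⟩
  · rintro ⟨h₁, h₂, h₃⟩
    refine ⟨fun hq => h₁ fun i j => hq i (Finset.mem_univ _) j (Finset.mem_univ _),
      fun p hp => ?_, fun p hp hq => ?_⟩
    · simp only [Finset.mem_filter, Finset.mem_univ, true_and] at hp
      exact h₂ _ _ _ hp.1 hp.2.1 hp.2.2
    · simp only [Finset.mem_filter, Finset.mem_univ, true_and] at hp
      exact h₃ _ _ hp fun k hk => hq k (Finset.mem_erase.2 ⟨hk, Finset.mem_univ _⟩)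

open scoped Classical in
theorem weight_cast_aux {R : Type*} [CommRing R] (P Q S : Prop) :
    (if P then (1 : R) else 0) * (2 - if Q then 1 else 0) + 2 * (if S then 1 else 0) =
      (((if P then (if Q then 1 else 2) else 0) + (if S then 2 else 0) : ℕ) : R) := by
  by_cases P <;> by_cases Q <;> by_cases S <;> simp [*] <;> norm_num

/-- Equality is stated in the ring of words, where the cast from ℤ is a ring homomorphism, so
negative signs need no separate treatment. -/
theorem eval_gridValue (h : HasTensor N D r E σ) {e : Fin (D + 1) → Expr}
    {c : Fin (D + 1) → ℕ} (he : ∀ i, Num σ (e i) (c i)) :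
    (gridValueExpr D r e).eval σ = ((gridValue N E c : ℤ) : BitVec w) := by
  classical
  have hw := h.width_pos
  have h1 : 1 < 2 ^ w := Nat.one_lt_two_pow hw.ne'
  have q := fun i => (he i).div h.succ
  have v := fun i => (he i).mod h.succ
  have q0 := fun i => (q i).eq (num_const (σ := σ) (Nat.two_pow_pos w))
  have q1 := fun i => (q i).eq (num_const (σ := σ) h1)
  have t₁ := Truth.prod (s := Finset.univ) fun i _ => (v i).eq h.num
  have t₂ := Truth.prod (s := Finset.univ) fun i _ => q0 i
  have t₃ := (Truth.prod (s := Finset.univ) fun i _ => ((v i).eq h.num).not hw).and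
    (h.truth_consistent he)
  simp only [Finset.mem_univ, true_imp_iff] at t₁ t₂ t₃
  unfold Truth at t₁ t₂ t₃ q0 q1
  rw [gridValueExpr, eval, BinOp.eval, eval_prod]
  simp only [eval, BinOp.eval] at t₁ t₂ t₃ q0 q1 ⊢
  rw [t₁, t₂, t₃, gridValue]
  push_cast
  congr 1
  · refine Finset.prod_congr rfl fun i _ => ?_
    rw [q0, q1, gridSign]
    split_ifs <;> simp
  · rw [weight]
    convert weight_cast_aux (R := BitVec w) _ _ _
    all_goals exact Nat.cast_ofNat (R := BitVec w)

theorem eval_cornerSign {d : ℕ} (δ : Fin d → Bool) :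
    (cornerSignExpr δ).eval σ = ((cornerSign δ : ℤ) : BitVec w) := by
  rw [cornerSignExpr, cornerSign, eval_prod]
  push_cast
  refine Finset.prod_congr rfl fun i _ => ?_
  cases δ i <;> simp [eval, BinOp.eval]

theorem num_coord (h : HasTensor N D r E σ) {s p : ℕ} (hp : Num σ (reg s) p) (i : Fin (D + 1))
    (b : Bool) : Num σ (coordExpr r s i b) (p / (8 * N) ^ (i : ℕ) % (8 * N) + b.toNat) := by
  have h₁ := h.pos
  have h₂ := h.eight_le
  have h₃ := Nat.mod_lt (p / (8 * N) ^ (i : ℕ)) (show 8 * N > 0 by omega)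
  have h₄ := Bool.toNat_le b
  exact ((hp.div (h.side.pow i (by omega)
    ((Nat.pow_le_pow_right (by omega) i.isLt.le).trans_lt h.lt))).mod h.side).add
    (num_const (by omega)) (by omega)

theorem eval_entry (h : HasTensor N D r E σ) {s p : ℕ} (hp : Num σ (reg s) p) :
    (entryExpr D r s).eval σ = ((mixedDiff (gridValue N E)
      (fun i : Fin (D + 1) => p / (8 * N) ^ (i : ℕ) % (8 * N)) : ℤ) : BitVec w) := by
  rw [entryExpr, eval_sum, mixedDiff]
  push_cast
  refine Finset.sum_congr rfl fun δ _ => ?_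
  rw [eval, BinOp.eval, eval_cornerSign, h.eval_gridValue fun i => h.num_coord hp i (δ i)]

end HasTensor

end CliqueArray

namespace CliqueArray

open WordRAM Expr

/-! ### Hypergraphs and subarrays -/

/-- The edge relation of a `3`-uniform hypergraph on natural numbers. -/
def edgeRel {N : ℕ} (G : UniformHypergraph 3 N) (a b c : ℕ) : Prop :=
  ∃ (ha : a < N) (hb : b < N) (hc : c < N),
    ({⟨a, ha⟩, ⟨b, hb⟩, ⟨c, hc⟩} : Finset (Fin N)) ∈ G.edges

variable {N D : ℕ}

theorem edgeRel_swap_left (G : UniformHypergraph 3 N) (a b c : ℕ) (h : edgeRel G a b c) :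
    edgeRel G b a c := by
  obtain ⟨ha, hb, hc, h⟩ := h
  exact ⟨hb, ha, hc, by rwa [Finset.insert_comm]⟩

theorem edgeRel_swap_right (G : UniformHypergraph 3 N) (a b c : ℕ) (h : edgeRel G a b c) :
    edgeRel G a c b := by
  obtain ⟨ha, hb, hc, h⟩ := h
  exact ⟨ha, hc, hb, by rwa [Finset.pair_comm]⟩

open scoped Classical in
theorem adj_eq (G : UniformHypergraph 3 N) (v : Fin 3 → Fin N) :
    G.adj v = if edgeRel G (v 0) (v 1) (v 2) then 1 else 0 := by
  have : Finset.univ.image v = {v 0, v 1, v 2} := by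
    ext x
    simp [Fin.exists_fin_succ, eq_comm]
  rw [UniformHypergraph.adj, this]
  have h : edgeRel G (v 0) (v 1) (v 2) ↔ {v 0, v 1, v 2} ∈ G.edges :=
    ⟨fun h => h.2.2.2, fun h => ⟨(v 0).isLt, (v 1).isLt, (v 2).isLt, h⟩⟩
  simp only [h]

theorem exists_family_of_isHyperclique {G : UniformHypergraph 3 N} {S : Finset (Fin N)}
    (hS : S.card = 2 * D) (h : G.IsHyperclique S) :
    ∃ f : Fin D × Bool → ℕ, (∀ p, f p < N) ∧ IsCliqueFamily (edgeRel G) f := by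
  have e : Fin D × Bool ≃ S := Fintype.equivOfCardEq (by simp [hS, mul_comm])
  refine ⟨fun p => (e p : Fin N), fun p => (e p : Fin N).isLt, fun p q r hpq hpr hqr => ?_⟩
  have ne : ∀ {p q}, p ≠ q → (e p : Fin N) ≠ e q := fun h h' => h (e.injective (Subtype.ext h'))
  refine ⟨Fin.isLt _, Fin.isLt _, Fin.isLt _, h _ ?_ ?_⟩
  · simp [Finset.insert_subset_iff]
  · exact Finset.card_eq_three.2 ⟨_, _, _, ne hpq, ne hpr, ne hqr, rfl⟩

/-- Distinctness comes for free: two indices with the same vertex, together with a third index,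
would give a hyperedge with fewer than three vertices. A third index exists because there are 2D ≥ 4
of them. -/
theorem exists_hyperclique_of_family {G : UniformHypergraph 3 N} (hD : 2 ≤ D)
    {f : Fin D × Bool → ℕ} (hf : ∀ p, f p < N) (h : IsCliqueFamily (edgeRel G) f) {k : ℕ}
    (g : Fin k → Fin D × Bool) (hg : Function.Injective g) :
    Function.Injective (fun i => (⟨f (g i), hf _⟩ : Fin N)) ∧
      G.IsHyperclique (Finset.univ.image fun i => (⟨f (g i), hf _⟩ : Fin N)) := by
  constructor
  · intro i j hij
    by_contra hne
    have hpq : g i ≠ g j := fun e => hne (hg e)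
    obtain ⟨r, hr⟩ : ∃ r, r ∉ ({g i, g j} : Finset (Fin D × Bool)) := by
      by_contra hall
      push Not at hall
      have h₁ := Finset.card_le_card (show Finset.univ ⊆ ({g i, g j} : Finset (Fin D × Bool))
        from fun r _ => hall r)
      have h₂ := Finset.card_le_two (a := g i) (b := g j)
      simp at h₁
      omega
    simp only [Finset.mem_insert, Finset.mem_singleton, not_or] at hr
    obtain ⟨_, _, _, he⟩ := h _ _ r hpq (Ne.symm hr.1) (Ne.symm hr.2)
    have hcard := G.uniform _ he
    simp only at hij
    rw [hij, Finset.insert_eq_of_mem (Finset.mem_insert_self _ _)] at hcard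
    have := Finset.card_le_two (a := (⟨f (g j), hf _⟩ : Fin N)) (b := ⟨f r, hf _⟩)
    omega
  · intro e he hcard
    obtain ⟨x, y, z, hxy, hxz, hyz, rfl⟩ := Finset.card_eq_three.1 hcard
    simp only [Finset.insert_subset_iff, Finset.singleton_subset_iff, Finset.mem_image,
      Finset.mem_univ, true_and] at he
    obtain ⟨⟨i, rfl⟩, ⟨j, rfl⟩, ⟨k, rfl⟩⟩ := he
    exact (h (g i) (g j) (g k) (fun e => hxy (by simp only [e])) (fun e => hxz (by simp only [e]))
      (fun e => hyz (by simp only [e]))).2.2.2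

/-- The array of a hypergraph. -/
noncomputable def instanceOf (D : ℕ) (G : UniformHypergraph 3 N) :
    (maxSubarrayProblem (D + 1) (2 ^ (2 * (D + 1)))).Inst (8 * N) :=
  ⟨fun x => mixedDiff (gridValue N (edgeRel G)) fun i => x i, fun x => by
    refine (abs_mixedDiff_gridValue_le _).trans ?_
    push_cast
    exact pow_le_pow_right₀ (by norm_num) (by omega)⟩

theorem correct_instanceOf (hD : 2 ≤ D) (hN : 0 < N) (G : UniformHypergraph 3 N) {out : ℕ → ℕ}
    (h : (maxSubarrayProblem (D + 1) (2 ^ (2 * (D + 1)))).Correct (instanceOf D G) out) :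
    (out 0 = N ∧ ¬∃ S : Finset (Fin N), S.card = 2 * D ∧ G.IsHyperclique S) ∨
    (out 0 ≠ N ∧ ∃ v : Fin (2 * D) → Fin N, Function.Injective v ∧
      G.IsHyperclique (Finset.univ.image v) ∧ (∀ i : Fin (2 * D), (i : ℕ) < D → v i = out i) ∧
      ∀ i : Fin (2 * D), D ≤ (i : ℕ) → N ≤ out (1 + i) ∧ v i = out (1 + i) - N) := by
  obtain ⟨lo, hi, hle, hmax, hout⟩ := h
  have symm₁ := edgeRel_swap_left G
  have symm₂ := edgeRel_swap_right G
  have sum_eq : ∀ lo hi : Fin (D + 1) → Fin (8 * N), lo ≤ hi →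
      ∑ x ∈ Finset.Icc lo hi, (instanceOf D G).1 x =
        boxSum N (edgeRel G) (fun i => lo i) (fun i => hi i + 1) :=
    fun lo hi h => sum_mixedDiff _ lo hi h
  have le_max : ∀ L R : Fin (D + 1) → ℕ, (∀ i, L i < R i) → (∀ i, R i ≤ 2 * N + 1) →
      boxSum N (edgeRel G) L R ≤
        boxSum N (edgeRel G) (fun i => lo i) (fun i => hi i + 1) := by
    intro L R hLR hR
    have h₁ := hmax (fun i => ⟨L i, by have := hLR i; have := hR i; omega⟩)
      (fun i => ⟨R i - 1, by have := hR i; omega⟩) (fun i => by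
        have := hLR i
        rw [Fin.le_iff_val_le_val]
        simp only
        omega)
    rw [sum_eq _ _ hle, sum_eq _ _ (fun i => by
        have := hLR i
        rw [Fin.le_iff_val_le_val]
        simp only
        omega)] at h₁
    have : (fun i => R i - 1 + 1) = R := funext fun i => by have := hLR i; omega
    simpa only [this] using h₁
  -- Comparison with the dummy box puts the optimal box within one of the upper bound.
  have hdummy := le_max (fun _ => N) (fun _ => 2 * N + 1) (fun _ => by omega) (fun _ => le_rfl)
  rw [boxSum_dummy] at hdummy
  obtain ⟨h₁, h₂⟩ := of_le_boxSum (R := fun i => hi i + 1) (by omega) symm₁ symm₂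
    (fun i => Nat.lt_succ_of_le (Fin.le_iff_val_le_val.1 (hle i))) hdummy
  have h0 : out 0 = lo 0 := (hout 0).1
  by_cases hdum : (lo 0 : ℕ) = N
  · refine Or.inl ⟨h0.trans hdum, ?_⟩
    rintro ⟨S, hS, hcl⟩
    obtain ⟨f, hf, hfam⟩ := exists_family_of_isHyperclique hS hcl
    obtain ⟨L, R, hLR, hR, hsum⟩ :=
      exists_boxSum_eq_of_isCliqueFamily symm₁ symm₂ f hf hN hfam
    have := le_max L R hLR hR
    have := h₁ hdum
    omega
  · refine Or.inr ⟨fun e => hdum (h0.symm.trans e), ?_⟩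
    obtain ⟨ends, hfam⟩ := h₂ hdum
    have hf : ∀ p : Fin D × Bool, (if p.2 then (hi p.1.castSucc : ℕ) + 1 - (N + 1)
        else lo p.1.castSucc) < N := by
      intro p
      have := ends p.1.castSucc
      split_ifs <;> omega
    let g : Fin (2 * D) → Fin D × Bool := fun i =>
      if h : (i : ℕ) < D then (⟨i, h⟩, false) else (⟨i - D, by omega⟩, true)
    have hg : Function.Injective g := by
      intro i j hij
      simp only [g] at hij
      split_ifs at hij <;> simp only [Prod.mk.injEq, Fin.mk.injEq, reduceCtorEq, and_false,
        and_true] at hij <;> omega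
    obtain ⟨hinj, hcl⟩ := exists_hyperclique_of_family hD hf hfam g hg
    refine ⟨_, hinj, hcl, fun i hi => ?_, fun i hi' => ?_⟩
    · simp only [g, dif_pos hi, Bool.false_eq_true, if_false]
      exact (hout ⟨i, by omega⟩).1.symm
    · have hnot : ¬(i : ℕ) < D := by omega
      simp only [g, dif_neg hnot, if_true]
      have e := (hout ⟨i - D, by omega⟩).2
      simp only at e
      -- The exclusive end is `hi + 1`, so the encoded vertex `hi + 1 - (N + 1)` is simply `hi - N`.
      rw [show D + 1 + ((i : ℕ) - D) = 1 + i by omega] at e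
      have := ends ⟨(i : ℕ) - D, by omega⟩
      rw [e]
      simp only [Fin.castSucc_mk]
      omega

end CliqueArray

namespace CliqueArray

open WordRAM Expr

/-! ### The reduction as a program -/

/-- Replace the adjacency tensor in memory by the array of the hypergraph; register `R` receives
the number of vertices, and the registers below `R` are not changed. -/
noncomputable def prepare (D R : ℕ) : Prog :=
  .seq (assign (R + 2) R (load (const 0)))
  (.seq (assign (R + 2) (R + 1) (op .mul (op .mul (reg R) (reg R)) (reg R)))
  (.seq (countdown (R + 2) (R + 1) (op .add (op .add (halfExpr D R) (const 1)) (reg (R + 1)))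
    (load (op .add (const 1) (reg (R + 1)))))
  (.seq (assign (R + 2) (R + 1) (halfExpr D R))
  (.seq (countdown (R + 2) (R + 1) (op .add (const 1) (reg (R + 1))) (entryExpr D R (R + 1)))
  (.seq (assign (R + 2) (R + 1) (halfExpr D R))
  (.seq (countdown (R + 2) (R + 1) (op .add (op .add (halfExpr D R) (const 1)) (reg (R + 1)))
    (const 0))
  (assignMem (R + 2) (const 0) (sideExpr R))))))))

/-- Turn a maximum subarray into the output for the hyperclique problem. -/
def extract (D R : ℕ) : Prog :=
  .seq (assign (R + 2) (R + 1) (op .eq (load (const 0)) (reg R)))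
  (.ite (R + 1) (assignMem (R + 2) (const 0) (const 0))
    (.seq (assign (R + 2) (R + 1) (const D))
    (.seq (countdown (R + 2) (R + 1) (op .add (const 1) (reg (R + 1))) (load (reg (R + 1))))
    (.seq (assign (R + 2) (R + 1) (const D))
    (.seq (countdown (R + 2) (R + 1) (op .add (const (D + 1)) (reg (R + 1)))
      (op .sub (load (op .add (const (D + 1)) (reg (R + 1)))) (reg R)))
    (assignMem (R + 2) (const 0) (const 1)))))))

theorem getD_cons_ofFn {m : ℕ} (z : ℤ) (f : Fin m → ℤ) (b : ℕ) :
    (z :: List.ofFn f).getD (1 + b) 0 = if h : b < m then f ⟨b, h⟩ else 0 := by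
  rw [add_comm, List.getD_cons_succ]
  split_ifs with h
  · rw [List.getD_eq_getElem _ _ (by simpa using h), List.getElem_ofFn]
  · rw [List.getD_eq_default _ _ (by simpa using h)]

open scoped Classical in
theorem cell_tensor {N : ℕ} (w k : ℕ) (G : UniformHypergraph 3 N) {a b c : ℕ} (ha : a < N)
    (hb : b < N) (hc : c < N) :
    BitVec.ofInt w (((hypercliqueProblem 3 k).input G).getD (1 + (a + b * N + c * (N * N))) 0) =
      if edgeRel G a b c then 1 else 0 := by
  have hlt : a + b * N + c * (N * N) < N ^ 3 := by
    rw [pow_succ, pow_two]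
    exact tensor_index_lt ha hb hc
  have e : finFunctionFinEquiv.symm ⟨a + b * N + c * (N * N), hlt⟩ =
      (![⟨a, ha⟩, ⟨b, hb⟩, ⟨c, hc⟩] : Fin 3 → Fin N) := by
    rw [Equiv.symm_apply_eq, Fin.ext_iff, finFunctionFinEquiv_apply, Fin.sum_univ_three]
    simp only [Matrix.cons_val, Fin.isValue]
    simp [pow_two]
  have h := getD_cons_ofFn N (fun i : Fin (N ^ 3) => G.adj (finFunctionFinEquiv.symm i))
    (a + b * N + c * (N * N))
  have hadj : G.adj ![⟨a, ha⟩, ⟨b, hb⟩, ⟨c, hc⟩] = if edgeRel G a b c then 1 else 0 :=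
    adj_eq G _
  rw [dif_pos hlt, e, hadj] at h
  simp only [hypercliqueProblem]
  rw [h]
  by_cases he : edgeRel G a b c
  · rw [if_pos he, if_pos he]
    rfl
  · rw [if_neg he, if_neg he]
    rfl

/-- In the upper half the last coordinate is at least 4N ≥ 2(N + 1), beyond both reserved ranges.
Hence the last grid sign is zero at every corner. -/
theorem mixedDiff_eq_zero {N D : ℕ} (E : ℕ → ℕ → ℕ → Prop) (hN : 0 < N) {p : ℕ}
    (h₁ : 4 * N * (8 * N) ^ D ≤ p) (h₂ : p < (8 * N) ^ (D + 1)) :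
    mixedDiff (gridValue N E) (fun i : Fin (D + 1) => p / (8 * N) ^ (i : ℕ) % (8 * N)) = 0 := by
  refine Finset.sum_eq_zero fun δ _ => ?_
  have hpos : 0 < (8 * N) ^ D := pow_pos (by omega) D
  have h₃ : 4 * N ≤ p / (8 * N) ^ D := (Nat.le_div_iff_mul_le hpos).2 h₁
  have h₄ : p / (8 * N) ^ D < 8 * N := (Nat.div_lt_iff_lt_mul hpos).2 (by rwa [← pow_succ'])
  have h₅ : 2 ≤ (p / (8 * N) ^ D % (8 * N) + (δ (Fin.last D)).toNat) / (N + 1) := by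
    rw [Nat.le_div_iff_mul_le N.succ_pos, Nat.mod_eq_of_lt h₄]
    omega
  rw [gridValue, Finset.prod_eq_zero (Finset.mem_univ (Fin.last D)), zero_mul, mul_zero]
  simp only [gridSign, Fin.val_last]
  rw [if_neg (by omega), if_neg (by omega), sub_zero]

theorem cost_aux {A H M c₁ c₂ c₃ S t : ℕ} (hA : A ≤ M) (hH : H ≤ M) (hM : 1 ≤ M)
    (ht : t = A * c₁ + H * c₂ + H * c₃ + S) : t ≤ (c₁ + c₂ + c₃ + S) * M := by
  have h₁ := Nat.mul_le_mul_right c₁ hA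
  have h₂ := Nat.mul_le_mul_right c₂ hH
  have h₃ := Nat.mul_le_mul_right c₃ hH
  have h₄ := Nat.mul_le_mul_left S hM
  rw [ht]
  linarith

theorem exec_prepare (D R k : ℕ) (hD : 2 ≤ D) : ∃ K : ℕ, ∀ (N : ℕ) (G : UniformHypergraph 3 N)
    (w : ℕ), 0 < N → (8 * N) ^ (D + 1) < 2 ^ w → ∃ (t : ℕ) (τ : State w),
      Exec (prepare D R) (initial w ((hypercliqueProblem 3 k).input G)) t τ ∧
      t ≤ K * (8 * N) ^ (D + 1) ∧
      τ.mem = (initial w ((maxSubarrayProblem (D + 1) (2 ^ (2 * (D + 1)))).input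
        (instanceOf D G))).mem ∧
      (τ.reg R).toNat = N ∧ ∀ s < R, τ.reg s = 0 := by
  refine ⟨countdownCost (op .add (op .add (halfExpr D R) (const 1)) (reg (R + 1)))
      (load (op .add (const 1) (reg (R + 1)))) +
    countdownCost (op .add (const 1) (reg (R + 1))) (entryExpr D R (R + 1)) +
    countdownCost (op .add (op .add (halfExpr D R) (const 1)) (reg (R + 1))) (const 0) +
    ((load (const 0)).cost + (op .mul (op .mul (reg R) (reg R)) (reg R)).cost +
      2 * (halfExpr D R).cost + (const 0).cost + (sideExpr R).cost + 8),
    fun N G w hN hw => ?_⟩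
  set σ := initial w ((hypercliqueProblem 3 k).input G) with hσ
  set H := 4 * N * (8 * N) ^ D with hH
  have hH2 : 2 * H = (8 * N) ^ (D + 1) := two_mul_half N D
  have hcube : N * N * N ≤ H := cube_le_half hN hD
  have h8 : 8 * N ≤ (8 * N) ^ (D + 1) := Nat.le_self_pow (Nat.succ_ne_zero D) _
  have hsq : N * N ≤ N * N * N := Nat.le_mul_of_pos_right _ hN
  let C₀ : ℕ → BitVec w := fun b => BitVec.ofInt w (((hypercliqueProblem 3 k).input G).getD b 0)
  -- the number of vertices
  obtain ⟨σ₁, x₁, m₁, v₁, r₁⟩ := exec_assign (R + 2) R (load (const 0)) σ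
  have hv₁ : (σ₁.reg R).toNat = N := by
    have : σ₁.reg R = BitVec.ofNat w N := by
      rw [v₁]
      simp [eval, hσ, initial, hypercliqueProblem]
    rw [this, BitVec.toNat_ofNat, Nat.mod_eq_of_lt (by omega)]
  have hz₁ : ∀ s < R, σ₁.reg s = 0 := fun s hs => r₁ s (by omega) (by omega)
  have keep : ∀ {ρ ρ' : State w}, HasSize N D R ρ →
      (∀ s < R + 2, s ≠ R + 1 → ρ'.reg s = ρ.reg s) → HasSize N D R ρ' := by
    intro ρ ρ' h hr
    refine ⟨hN, hD, hw, ?_⟩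
    have := h.num
    rw [Expr.Num, eval] at this ⊢
    rwa [hr R (by omega) (by omega)]
  have s₁ : HasSize N D R σ₁ := ⟨hN, hD, hw, hv₁⟩
  -- copying the tensor
  obtain ⟨σ₂, x₂, m₂, v₂, r₂⟩ := exec_assign (R + 2) (R + 1)
    (op .mul (op .mul (reg R) (reg R)) (reg R)) σ₁
  have s₂ := keep s₁ r₂
  have hv₂ : (σ₂.reg (R + 1)).toNat = N * N * N := by
    rw [v₂]
    exact (s₁.num.mul s₁.num (by omega)).mul s₁.num (by omega)
  -- The sources, cells 1 to N³, lie below the target range starting at `H + 1`, since N³ ≤ `H`.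
  obtain ⟨σ₃, x₃, r₃, m₃⟩ := exec_countdown (R + 2) (R + 1) (by omega)
    (op .add (op .add (halfExpr D R) (const 1)) (reg (R + 1)))
    (load (op .add (const 1) (reg (R + 1)))) (H + 1) (N * N * N) C₀ (fun i => C₀ (1 + i)) σ₂
    (by rw [m₂, m₁]; rfl) hv₂ (fun i hi τ hr hi' hm => by
      have s := keep s₂ hr
      have hi'' : Num τ (reg (R + 1)) i := hi'
      refine ⟨((s.half.add (num_const (by omega)) (by omega)).add hi'' (by omega)), ?_⟩
      have e : Num τ (op .add (const 1) (reg (R + 1))) (1 + i) :=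
        (num_const (by omega)).add hi'' (by omega)
      rw [Expr.Num] at e
      rw [eval, hm]
      simp only [e, filled]
      rw [if_neg (by omega)])
  set C₁ := filled C₀ (H + 1) (fun i => C₀ (1 + i)) 0 (N * N * N) with hC₁
  have s₃ := keep s₂ r₃
  -- filling the lower half
  obtain ⟨σ₄, x₄, m₄, v₄, r₄⟩ := exec_assign (R + 2) (R + 1) (halfExpr D R) σ₃
  have s₄ := keep s₃ r₄
  obtain ⟨σ₅, x₅, r₅, m₅⟩ := exec_countdown (R + 2) (R + 1) (by omega)
    (op .add (const 1) (reg (R + 1))) (entryExpr D R (R + 1)) 1 H C₁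
    (fun i => ((mixedDiff (gridValue N (edgeRel G))
      (fun j : Fin (D + 1) => i / (8 * N) ^ (j : ℕ) % (8 * N)) : ℤ) : BitVec w)) σ₄
    (by rw [m₄, m₃]) (by rw [v₄]; exact s₃.half) (fun i hi τ hr hi' hm => by
      have s := keep s₄ hr
      have hi'' : Num τ (reg (R + 1)) i := hi'
      refine ⟨(num_const (by omega)).add hi'' (by omega), ?_⟩
      refine HasTensor.eval_entry ⟨s, fun a b c ha hb hc => ?_⟩ hi''
      have hidx := tensor_index_lt ha hb hc
      rw [hm, ← cell_tensor w k G ha hb hc]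
      simp only [← hH, BitVec.toNat_ofNat]
      rw [Nat.mod_eq_of_lt (by omega), filled, if_neg (by omega), hC₁, filled,
        if_pos (by omega)]
      simp only [C₀, Nat.add_sub_cancel_left])
  set C₂ := filled C₁ 1 (fun i => ((mixedDiff (gridValue N (edgeRel G))
      (fun j : Fin (D + 1) => i / (8 * N) ^ (j : ℕ) % (8 * N)) : ℤ) : BitVec w)) 0 H with hC₂
  have s₅ := keep s₄ r₅
  -- clearing the upper half
  obtain ⟨σ₆, x₆, m₆, v₆, r₆⟩ := exec_assign (R + 2) (R + 1) (halfExpr D R) σ₅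
  have s₆ := keep s₅ r₆
  obtain ⟨σ₇, x₇, r₇, m₇⟩ := exec_countdown (R + 2) (R + 1) (by omega)
    (op .add (op .add (halfExpr D R) (const 1)) (reg (R + 1))) (const 0) (H + 1) H C₂
    (fun _ => BitVec.ofNat w 0) σ₆
    (by rw [m₆, m₅]) (by rw [v₆]; exact s₅.half) (fun i hi τ hr hi' hm => by
      have s := keep s₆ hr
      have hi'' : Num τ (reg (R + 1)) i := hi'
      exact ⟨((s.half.add (num_const (by omega)) (by omega)).add hi'' (by omega)), rfl⟩)
  have s₇ := keep s₆ r₇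
  -- the side length
  obtain ⟨σ₈, x₈, m₈, r₈⟩ := exec_assignMem (R + 2) (const 0) (sideExpr R) σ₇
  refine ⟨_, σ₈, .seq x₁ (.seq x₂ (.seq x₃ (.seq x₄ (.seq x₅ (.seq x₆ (.seq x₇ x₈)))))),
    ?_, ?_, ?_, fun s hs => ?_⟩
  · exact cost_aux (A := N * N * N) (H := H) (by omega) (by omega) (by omega) (by ring)
  · rw [m₈, m₇, s₇.side.eval_eq]
    funext a
    simp only [initial, eval]
    by_cases ha : a = BitVec.ofNat w 0
    · rw [ha, Function.update_self]
      rw [← BitVec.ofInt_natCast]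
      simp [maxSubarrayProblem]
    · rw [Function.update_of_ne ha]
      obtain ⟨b, hb⟩ : ∃ b, a.toNat = 1 + b := by
        refine Nat.exists_eq_add_of_le (Nat.one_le_iff_ne_zero.2 fun h => ha ?_)
        exact BitVec.eq_of_toNat_eq (by simpa using h)
      simp only [maxSubarrayProblem, hb, getD_cons_ofFn]
      rw [filled]
      split_ifs with h₁ h₂ h₂
      · simp only [instanceOf, finFunctionFinEquiv_symm_apply_val]
        rw [mixedDiff_eq_zero _ hN (by omega) h₂]
        rfl
      · rfl
      · have hbH : b < H := by omega
        rw [hC₂, filled, if_pos (by omega)]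
        simp only [instanceOf, finFunctionFinEquiv_symm_apply_val, Nat.add_sub_cancel_left]
        rfl
      -- Past the array the original input is untouched, and it is zero there because the tensor
      -- ended earlier.
      · have hbH : 2 * H ≤ b := by omega
        rw [hC₂, filled, if_neg (by omega), hC₁, filled, if_neg (by omega)]
        simp only [C₀, hypercliqueProblem, getD_cons_ofFn]
        rw [dif_neg (by rw [pow_succ, pow_two]; omega)]
  · rw [r₈ R (by omega)]
    exact s₇.num
  · rw [r₈ s (by omega), r₇ s (by omega) (by omega), r₆ s (by omega) (by omega),
      r₅ s (by omega) (by omega), r₄ s (by omega) (by omega), r₃ s (by omega) (by omega),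
      r₂ s (by omega) (by omega), hz₁ s hs]

theorem exec_extract (D R : ℕ) : ∃ K : ℕ, ∀ (N w : ℕ) (σ : State w), (σ.reg R).toNat = N →
    2 * D + 2 < 2 ^ w → ∃ (t : ℕ) (τ : State w), Exec (extract D R) σ t τ ∧ t ≤ K ∧
      (σ.output 0 = N → τ.output 0 = 0) ∧ (σ.output 0 ≠ N → τ.output 0 = 1 ∧
        (∀ i < D, τ.output (1 + i) = σ.output i) ∧ ∀ i, D ≤ i → i < 2 * D →
          N ≤ σ.output (1 + i) → τ.output (1 + i) = σ.output (1 + i) - N) := by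
  refine ⟨(op .eq (load (const 0)) (reg R)).cost + (const 0).cost + (const 0).cost +
    (const D).cost + (const D).cost +
    D * countdownCost (op .add (const 1) (reg (R + 1))) (load (reg (R + 1))) +
    D * countdownCost (op .add (const (D + 1)) (reg (R + 1)))
      (op .sub (load (op .add (const (D + 1)) (reg (R + 1)))) (reg R)) +
    (const 0).cost + (const 1).cost + 10, fun N w σ hN hw => ?_⟩
  have h1 : (BitVec.ofNat w 1).toNat = 1 := by
    rw [BitVec.toNat_ofNat, Nat.mod_eq_of_lt (by omega)]
  have small : ∀ i ≤ 2 * D + 2, (BitVec.ofNat w i).toNat = i := fun i hi => by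
    rw [BitVec.toNat_ofNat, Nat.mod_eq_of_lt (by omega)]
  have hR : Num σ (reg R) N := hN
  obtain ⟨C, hC⟩ : ∃ C : ℕ → BitVec w, σ.mem = fun a => C a.toNat :=
    ⟨fun b => σ.mem (BitVec.ofNat w b), by
      funext a
      simp only
      rw [BitVec.ofNat_toNat, BitVec.setWidth_eq]⟩
  have out : ∀ i ≤ 2 * D + 2, σ.output i = (C i).toNat := fun i hi => by
    rw [State.output, hC]
    simp only [small i hi]
  obtain ⟨σ₁, x₁, m₁, v₁, r₁⟩ := exec_assign (R + 2) (R + 1) (op .eq (load (const 0)) (reg R)) σ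
  have hflag : Truth σ (op .eq (load (const 0)) (reg R)) (σ.output 0 = N) :=
    Num.eq (k := σ.output 0) (by rw [Expr.Num, eval, eval, State.output]) hR
  unfold Truth at hflag
  rw [← v₁] at hflag
  by_cases h0 : σ.output 0 = N
  · rw [if_pos h0] at hflag
    obtain ⟨σ₂, x₂, m₂, r₂⟩ := exec_assignMem (R + 2) (const 0) (const 0) σ₁
    refine ⟨_, σ₂, .seq x₁ (.ite_true ?_ x₂), by omega, fun _ => ?_, fun h => (h h0).elim⟩
    · rw [hflag]
      intro h
      have := congrArg BitVec.toNat h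
      rw [show (1 : BitVec w).toNat = 1 from h1] at this
      simp at this
    · rw [State.output, m₂]
      simp [eval]
  · rw [if_neg h0] at hflag
    obtain ⟨σ₂, x₂, m₂, v₂, r₂⟩ := exec_assign (R + 2) (R + 1) (const D) σ₁
    -- The lower ends move up one cell to make room for the flag; counting down reads each of them
    -- before it is overwritten.
    obtain ⟨σ₃, x₃, r₃, m₃⟩ := exec_countdown (R + 2) (R + 1) (by omega)
      (op .add (const 1) (reg (R + 1))) (load (reg (R + 1))) 1 D C C σ₂ (by rw [m₂, m₁, hC])
      (by rw [v₂]; exact small D (by omega)) (fun i hi τ hr hi' hm => by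
        have hi'' : Num τ (reg (R + 1)) i := hi'
        refine ⟨(num_const (by omega)).add hi'' (by omega), ?_⟩
        rw [eval, hm, eval]
        simp only [hi', filled]
        rw [if_neg (by omega)])
    obtain ⟨σ₄, x₄, m₄, v₄, r₄⟩ := exec_assign (R + 2) (R + 1) (const D) σ₃
    have hN₄ : σ₄.reg R = σ.reg R := by
      rw [r₄ R (by omega) (by omega), r₃ R (by omega) (by omega), r₂ R (by omega) (by omega),
        r₁ R (by omega) (by omega)]
    -- The upper ends already occupy their final cells: the checksum's lower end in cell `D` has
    -- been overwritten by the shift. Only `N` is left to be subtracted.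
    obtain ⟨σ₅, x₅, r₅, m₅⟩ := exec_countdown (R + 2) (R + 1) (by omega)
      (op .add (const (D + 1)) (reg (R + 1)))
      (op .sub (load (op .add (const (D + 1)) (reg (R + 1)))) (reg R)) (D + 1) D
      (filled C 1 C 0 D) (fun i => C (D + 1 + i) - σ.reg R) σ₄ (by rw [m₄, m₃])
      (by rw [v₄]; exact small D (by omega)) (fun i hi τ hr hi' hm => by
        have hi'' : Num τ (reg (R + 1)) i := hi'
        have e : Num τ (op .add (const (D + 1)) (reg (R + 1))) (D + 1 + i) :=
          (num_const (by omega)).add hi'' (by omega)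
        refine ⟨e, ?_⟩
        rw [Expr.Num] at e
        rw [eval, BinOp.eval, Expr.eval.eq_4, hm, eval, hr R (by omega) (by omega), hN₄]
        simp only [e, filled]
        rw [if_neg (by omega), if_neg (by omega)])
    obtain ⟨σ₆, x₆, m₆, r₆⟩ := exec_assignMem (R + 2) (const 0) (const 1) σ₅
    refine ⟨_, σ₆, .seq x₁ (.ite_false hflag (.seq x₂ (.seq x₃ (.seq x₄ (.seq x₅ x₆))))),
      by omega, fun h => (h0 h).elim, fun _ => ?_⟩
    have out' : ∀ i ≤ 2 * D, σ₆.output (1 + i) =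
        (filled (filled C 1 C 0 D) (D + 1) (fun i => C (D + 1 + i) - σ.reg R) 0 D
          (1 + i)).toNat := by
      intro i hi
      have hne : BitVec.ofNat w (1 + i) ≠ BitVec.ofNat w 0 := by
        intro h
        have := congrArg BitVec.toNat h
        rw [small _ (by omega), small _ (by omega)] at this
        omega
      rw [State.output, m₆, eval, Function.update_of_ne hne, m₅]
      simp only [small (1 + i) (by omega)]
    refine ⟨?_, fun i hi => ?_, fun i hi hi' hle => ?_⟩
    · rw [State.output, m₆, eval, Function.update_self]
      exact h1
    · rw [out' i (by omega), out i (by omega), filled, if_neg (by omega), filled,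
        if_pos (by omega), Nat.add_sub_cancel_left]
    · rw [out (1 + i) (by omega)] at hle ⊢
      rw [out' i (by omega), filled, if_pos (by omega),
        show D + 1 + (1 + i - (D + 1)) = 1 + i by omega,
        BitVec.toNat_sub_of_le (by rw [BitVec.le_def]; omega), hN]

end CliqueArray

/-! ### The complete reduction and its running time -/

open WordRAM CliqueArray

/-- The hyperclique problem reduces to the maximum subarray problem on arrays of side length
`8 * N`, by a program running in time linear in the size of the array. -/
theorem hyperclique_reduction (D : ℕ) (hD : 2 ≤ D) (p : Prog) : ∃ (P : Prog) (K : ℕ), ∀ (N w : ℕ)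
    (G : UniformHypergraph 3 N), 0 < N →
    Fits w ((maxSubarrayProblem (D + 1) (2 ^ (2 * (D + 1)))).input (instanceOf D G)) →
    ∀ (t : ℕ) (τ : State w),
      Exec p (initial w ((maxSubarrayProblem (D + 1) (2 ^ (2 * (D + 1)))).input
        (instanceOf D G))) t τ →
      (maxSubarrayProblem (D + 1) (2 ^ (2 * (D + 1)))).Correct (instanceOf D G) τ.output →
      Fits w ((hypercliqueProblem 3 (2 * D)).input G) ∧ ∃ (t' : ℕ) (τ' : State w),
        Exec P (initial w ((hypercliqueProblem 3 (2 * D)).input G)) t' τ' ∧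
        t' ≤ t + K * N ^ (D + 1) ∧ (hypercliqueProblem 3 (2 * D)).Correct G τ'.output := by
  obtain ⟨K₁, h₁⟩ := exec_prepare D p.bound (2 * D) hD
  obtain ⟨K₂, h₂⟩ := exec_extract D p.bound
  refine ⟨.seq (prepare D p.bound) (.seq p (extract D p.bound)), K₁ * 8 ^ (D + 1) + K₂,
    fun N w G hN hfit t τ hexec hcorrect => ?_⟩
  have hlt : (8 * N) ^ (D + 1) < 2 ^ w := by
    have := hfit.1
    simp only [maxSubarrayProblem, List.length_cons, List.length_ofFn] at this
    omega
  have h8 : 8 * N ≤ (8 * N) ^ (D + 1) := Nat.le_self_pow (Nat.succ_ne_zero D) _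
  have hone : 1 ≤ N ^ (D + 1) := Nat.one_le_pow _ _ hN
  have hsmall : 2 * D + 2 < 2 ^ w := by
    have e₁ : D + 1 < 4 ^ (D + 1) := Nat.lt_pow_self (by norm_num)
    have e₂ : 2 ^ (D + 1) * 4 ^ (D + 1) ≤ (8 * N) ^ (D + 1) := by
      rw [← mul_pow]
      exact Nat.pow_le_pow_left (by omega) _
    have e₃ : 2 ≤ 2 ^ (D + 1) := Nat.le_self_pow (Nat.succ_ne_zero D) _
    nlinarith
  refine ⟨⟨?_, ?_⟩, ?_⟩
  · have e₁ := cube_le_half hN hD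
    have e₂ := two_mul_half N D
    simp only [hypercliqueProblem, List.length_cons, List.length_ofFn]
    rw [pow_succ, pow_two]
    omega
  -- The first input word of the array instance is its side length `8 * N`, and it fits as a signed
  -- number.
  · have hbig : (16 * N : ℤ) < 2 ^ w := by
      have := hfit.2 (8 * N : ℕ) (by simp [maxSubarrayProblem])
      push_cast at this
      linarith
    intro z hz
    simp only [hypercliqueProblem, List.mem_cons, List.mem_ofFn] at hz
    rcases hz with rfl | ⟨i, rfl⟩
    · constructor <;> omega
    · unfold UniformHypergraph.adj
      split_ifs <;> constructor <;> omega
  · obtain ⟨t₁, τ₁, x₁, ht₁, m₁, hN₁, hz₁⟩ := h₁ N G w hN hlt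
    obtain ⟨τ₂, x₂, m₂, -, r₂⟩ := hexec.frame p.bound le_rfl τ₁ m₁ hz₁
    obtain ⟨t₃, τ₃, x₃, ht₃, hno, hyes⟩ := h₂ N w τ₂ (by rw [r₂ _ le_rfl, hN₁]) hsmall
    have hout : τ₂.output = τ.output := by
      funext i
      rw [State.output, State.output, m₂]
    rw [hout] at hno hyes
    refine ⟨_, τ₃, .seq x₁ (.seq x₂ x₃), ?_, ?_⟩
    · rw [mul_pow, ← mul_assoc] at ht₁
      have := Nat.mul_le_mul_left K₂ hone
      rw [add_mul]
      omega
    · rcases correct_instanceOf hD hN G hcorrect with ⟨h0, hnone⟩ | ⟨h0, v, hinj, hcl, ha, hb⟩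
      · exact Or.inr ⟨hno h0, hnone⟩
      · obtain ⟨hflag, hlow, hhigh⟩ := hyes h0
        refine Or.inl ⟨hflag, v, hinj, hcl, fun i => ?_⟩
        rcases lt_or_ge (i : ℕ) D with hi | hi
        · rw [hlow i hi, ha i hi]
        · rw [hhigh i hi i.isLt (hb i hi).1, (hb i hi).2]

theorem theorem4 :
    ∃ C : ℕ, ∀ d : ℕ, 3 ≤ d → HypercliqueHypothesis 3 (2 * d - 2) →
      (maxSubarrayProblem d (2 ^ (C * d))).RequiresExponent (2 * (d : ℝ) - 2) := by
  -- Entries are sums of 2^d terms of size at most 2, and 2^(d+1) ≤ 2^(2d).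
  refine ⟨2, fun d hd hyp ε hε => ?_⟩
  obtain ⟨D, rfl⟩ : ∃ D, d = D + 1 := ⟨d - 1, by omega⟩
  rw [show 2 * (D + 1) - 2 = 2 * D by omega] at hyp
  have hD : 2 ≤ D := by omega
  rintro ⟨p, a, b, K, h⟩
  obtain ⟨P, K', hP⟩ := hyperclique_reduction D hD p
  -- Capping ε at 1 gives D + 1 ≤ 2D - min ε 1, which absorbs the cost of building the array. The
  -- word length gains 3a because log₂ (8N) exceeds log₂ N by 3; `max K 0` guards against a negative
  -- constant.
  refine hyp (min ε 1) (lt_min hε one_pos)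
    ⟨P, a, a * 3 + b, max K 0 * 8 ^ (2 * (D : ℝ) - min ε 1) + K', fun N hN G => ?_⟩
  have hlog : Nat.log 2 (8 * N) = Nat.log 2 N + 3 := by
    rw [show 8 * N = N * 2 * 2 * 2 by ring, Nat.log_mul_base one_lt_two (by omega),
      Nat.log_mul_base one_lt_two (by omega), Nat.log_mul_base one_lt_two (by omega)]
  have hw : a * Nat.log 2 N + (a * 3 + b) = a * Nat.log 2 (8 * N) + b := by
    rw [hlog]
    ring
  rw [hw]
  obtain ⟨hfit, t, τ, hexec, ht, hcorrect⟩ := h (8 * N) (by omega) (instanceOf D G)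
  obtain ⟨hfit', t', τ', hexec', ht', hcorrect'⟩ := hP N _ G hN hfit t τ hexec hcorrect
  refine ⟨hfit', t', τ', hexec', ?_, hcorrect'⟩
  have hN1 : (1 : ℝ) ≤ N := by exact_mod_cast hN
  have hD' : (2 : ℝ) ≤ D := by exact_mod_cast hD
  set e : ℝ := 2 * (D : ℝ) - min ε 1 with he
  have hcast : ((2 * D : ℕ) : ℝ) - min ε 1 = e := by push_cast; rfl
  rw [hcast]
  have h₁ : (t : ℝ) ≤ max K 0 * 8 ^ e * (N : ℝ) ^ e := by
    rw [mul_assoc, ← Real.mul_rpow (by norm_num) (by linarith)]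
    refine ht.trans ?_
    push_cast
    refine mul_le_mul (le_max_left _ _) (Real.rpow_le_rpow_of_exponent_le (by linarith) ?_)
      (Real.rpow_nonneg (by linarith) _) (le_max_right _ _)
    have := min_le_left ε 1
    linarith
  have h₂ : (N : ℝ) ^ (D + 1) ≤ (N : ℝ) ^ e := by
    rw [← Real.rpow_natCast]
    refine Real.rpow_le_rpow_of_exponent_le hN1 ?_
    have := min_le_right ε 1
    push_cast
    linarith
  have h₃ : (t' : ℝ) ≤ t + K' * (N : ℝ) ^ (D + 1) := by exact_mod_cast ht'
  have h₄ := mul_le_mul_of_nonneg_left h₂ (Nat.cast_nonneg (α := ℝ) K')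
  simp only
  rw [add_mul]
  linarith
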